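/- **Setting.** Let $f:\mathbb R^d\to\mathbb R$ be $L$-smooth ($L>0$) and bounded below by $f_*$, and let $\nabla f(x,\xi)$, $\xi\sim\mathcal D$, be jointly measurable stochastic gradients. Assume that for some $\sigma>0$ and $s_0\ge 1$, for every $x$ and every set $S$ of $s\ge s_0$ coordinates: 1. $\mathbb E[\nabla f(x,\xi)]=\nabla f(x)$ and $\mathbb E\|\nabla_{[S]}f(x,\xi)-\nabla_{[S]}f(x)\|^2\le s\sigma^2/d$; 2. $\mathbb P\{\|\frac1k\sum_{i=1}^k\nabla_{[S]}f(x,\xi_i)-\nabla_{[S]}f(x)\|^2>\frac{ts\sigma^2}{kd}\}<\frac1{t^2}$ for all $t>0$, $k\ge1$ and i.i.d. $\xi_1,\dots,\xi_k\sim\mathcal D$. There are $n$ peers with $n s_0\le d$ (so every part of the vector below has at least $s_0$ coordinates), and $b=\delta n$ of them are Byzantine, controlled by one omniscient adversary. Let $m\ge1$, $b\le 0.1(n-m)$ and $m\le (n-2b)/2$. **BTARD-SGD.** In iteration $k$ there are $n_k$ active peers ($n_0=n$); the validators $\mathcal C_k$ ($\mathcal C_0=\varnothing$) do not take part in the aggregation,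 and the other active peers are the participants. Participant $i$ commits to a vector $g_i$; the protocol prescribes $g_i=\nabla f(x^k,\xi_{i,k})$, with $\xi_{i,k}$ i.i.d. $\sim\mathcal D$ and independent of the past. Vectors are split into consecutive parts of almost equal size, one per participant. Participant $j$ announces an aggregate $\widehat g(j)$ of the $j$-th parts; the protocol prescribes an exact solution $v$ of the CenteredClip equation $\sum_i (g_i(j)-v)\min\{1,\tau/\|g_i(j)-v\|\}=0$, the sum being over all participants $i$. Then each participant $i$ broadcasts for every part $j$ the norm $\|g_i(j)-\widehat g(j)\|$ and the inner product of $z(j)$ with $(g_i(j)-\widehat g(j))\min\{1,\tau/\|g_i(j)-\widehat g(j)\|\}$, where $z$ is a common unit vector. *Verifications.* A peer whose norm or inner product for the part of a good aggregator is wrong is banned. Part $j$ is re-aggregated by all peers if its reported inner products do not sum to zero, or if more than half of the participants report a norm above $\Delta_{\max}^k$ (Verification 3). If this shows that the announced part was wrong, it is replaced by a correct one and its aggregator is banned. Together the parts form $\widehat g^k$, and $x^{k+1}=x^k-\gamma\widehat g^k$. *Attackers.* The attackers of iteration $k$ are the participants whose vector, aggregate, or reports are not as prescribed; good peers never attack.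 Attackers may choose their messages with knowledge of everything, including all current samples, but not of the later draw of validators. The exact number $\widehat b_k$ of attackers is fixed and known to all good peers when iteration $k$ starts, and $\widehat\delta_k=\widehat b_k/(n_k-m)$ is used for the clipping radius: $\tau=\infty$ if $\widehat\delta_k=0$, and otherwise $$\tau=4\sqrt{\frac{(1-\widehat\delta_k)(B^2/3+v_j)}{\sqrt3\,\widehat\delta_k}},\qquad B^2=\frac{5v_j}{1-6.45\,\widehat\delta_k},$$ where $v_j=2d_j\sigma^2/d$ bounds the pairwise variance of honest $j$-th parts and $d_j$ is the size of the part. *Bans.* The adversary may in each iteration also remove Byzantine peers and, for each of them, at most one good peer. After the aggregation and the removals of iteration $k$, $m$ validators (forming $\mathcal C_{k+1}$) and $m$ peers to be checked, one by each validator, are drawn uniformly without replacement from the remaining peers. An attacker of iteration $k$ that is checked by a good validator is banned, and the ban takes effect at the end of iteration $k+1$. **Theorem.** There is an absolute constant $C>0$ such that the following holds for all such data, every $\varepsilon>0$ and every starting point $x^0$, with $\Delta_0=f(x^0)-f_*$. If an integer $K\ge1$ satisfies $$K\ \ge\ C\left(\frac{L\Delta_0}{\varepsilon^2}+\frac{L\Delta_0\sigma^2}{n\varepsilon^4}+\frac{n\delta\sigma^2}{m\varepsilon^2}\right),$$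 then $K$ iterations of BTARD-SGD with $$\gamma=\min\left\{\frac1{4L},\sqrt{\frac{\Delta_0n}{L\sigma^2K}}\right\},\qquad \Delta_{\max}^k=\frac{(1+\sqrt3)\sqrt2\,\sigma}{\sqrt{n_k-m}}$$ satisfy, against every such adversary, $\mathbb E\|\nabla f(\overline x^K)\|^2\le\varepsilon^2$, where $\overline x^K$ is picked uniformly at random from $\{x^0,\dots,x^{K-1}\}$. In particular, $K={\cal O}\left(\frac{L\Delta_0}{\varepsilon^2}+\frac{L\Delta_0\sigma^2}{n\varepsilon^4}+\frac{n\delta\sigma^2}{m\varepsilon^2}\right)$ iterations (and at least one) suffice. -/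

import Mathlib

open MeasureTheory ProbabilityTheory Finset
open scoped ENNReal

noncomputable section

/-! ### The problem -/

/-- The parameter space `ℝ^d` with its Euclidean norm. -/
abbrev Vec (d : ℕ) : Type := EuclideanSpace ℝ (Fin d)

/-- The subvector `v_[S]` of `v` with the coordinates in `S`. -/
def subvec {d : ℕ} (S : Finset (Fin d)) (v : Vec d) : EuclideanSpace ℝ S :=
  WithLp.toLp 2 (fun c : S => v c)

/-- `f` is `L`-smooth on `ℝ^d`. -/
def LSmooth {d : ℕ} (f : Vec d → ℝ) (L : ℝ) : Prop :=
  Differentiable ℝ f ∧ ∀ x y, ‖gradient f x - gradient f y‖ ≤ L * ‖x - y‖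

/-- Unbiased stochastic gradients `g x ξ` of `f` whose noise has block-wise bounded variance:
every subvector of size `s ≥ s₀` has variance at most `s σ² / d`. -/
def BlockVariance {d : ℕ} {Ξ : Type*} [MeasurableSpace Ξ] (D : Measure Ξ)
    (g : Vec d → Ξ → Vec d) (f : Vec d → ℝ) (σ : ℝ) (s₀ : ℕ) : Prop :=
  ∀ x, Integrable (g x) D ∧ ∫ ξ, g x ξ ∂D = gradient f x ∧
    ∀ S : Finset (Fin d), s₀ ≤ #S →
      ∫⁻ ξ, ‖subvec S (g x ξ) - subvec S (gradient f x)‖ₑ ^ 2 ∂D ≤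
        ENNReal.ofReal (#S * σ ^ 2 / d)

/-- Sub-quadratically decreasing tails of the averages of `k` i.i.d. stochastic gradients. -/
def SubQuadraticTails {d : ℕ} {Ξ : Type*} [MeasurableSpace Ξ] (D : Measure Ξ)
    (g : Vec d → Ξ → Vec d) (f : Vec d → ℝ) (σ : ℝ) (s₀ : ℕ) : Prop :=
  ∀ (x : Vec d) (S : Finset (Fin d)), s₀ ≤ #S → ∀ k : ℕ, 0 < k → ∀ t : ℝ, 0 < t →
    (Measure.pi fun _ : Fin k => D)
      {ζ | t * #S * σ ^ 2 / (k * d) <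
        ‖(1 / (k : ℝ)) • ∑ i, subvec S (g x (ζ i)) - subvec S (gradient f x)‖ ^ 2} <
      ENNReal.ofReal (1 / t ^ 2)

/-! ### Splitting a vector and CenteredClip -/

/-- First coordinate of part number `j` (counted from `0`) when `d` coordinates are split into `a`
consecutive parts, the first `d % a` of them of size `d / a + 1`, the others of size `d / a`. -/
def splitStart (d a j : ℕ) : ℕ := j * (d / a) + min j (d % a)

/-- The coordinates of part number `j` in this splitting. -/
def splitPart (d a j : ℕ) : Finset (Fin d) :=
  Finset.univ.filter fun c => splitStart d a j ≤ (c : ℕ) ∧ (c : ℕ) < splitStart d a (j + 1)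

/-- The clipping radius `τ = 4 √((1 - δ)(B²/3 + v) / (√3 δ))`, where `v` bounds the pairwise variance
`E‖x_i - x_j‖²` of the honest inputs and `B² = 5 v / (1 - 6.45 δ)` is the limit of the recursion
`B_{l+1}² = 6.45 δ B_l² + 5 v`. Only used for `0 < δ`. -/
def clipRadius (δ v : ℝ) : ℝ :=
  4 * √((1 - δ) * (5 * v / (1 - 6.45 * δ) / 3 + v) / (√3 * δ))

/-- `y ↦ y · min {1, τ / ‖y‖}`; for `δ = 0` the radius is infinite and nothing is clipped. -/
def clip {V : Type*} [NormedAddCommGroup V] [NormedSpace ℝ V] (δ v : ℝ) (y : V) : V :=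
  (if δ = 0 then 1 else min 1 (clipRadius δ v / ‖y‖)) • y

/-! ### One call of BTARD -/

/-- What happens in one iteration up to the verifications. Peers are numbered by `Fin n`. -/
structure Round (d n : ℕ) where
  /-- the peers not removed so far, `G_k ∪ B_k` -/
  active : Finset (Fin n)
  /-- the peers `C_k` that validate others instead of computing gradients -/
  validators : Finset (Fin n)
  /-- the stochastic gradients `∇f(x^k, ξ_{i,k})` prescribed by the public seeds -/
  grad : Fin n → Vec d
  /-- the number `b̂_k` of attackers known to the good peers -/
  numAttack : ℕ
  /-- the vectors to which the peers commit and whose parts they send -/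
  sent : Fin n → Vec d
  /-- all parts announced by their aggregators, merged into one vector -/
  announced : Vec d
  /-- the direction `z` of the second verification -/
  dir : Vec d
  /-- `normRep i j` is the broadcast value of `‖g_i(j) - ĝ(j)‖` -/
  normRep : Fin n → Fin n → ℝ
  /-- `innerRep i j` is the broadcast value of `⟨z(j), Δ_i^j⟩` -/
  innerRep : Fin n → Fin n → ℝ

namespace Round

variable {d n : ℕ}

/-- The peers that take part in the aggregation. -/
def participants (R : Round d n) : Finset (Fin n) := R.active \ R.validators

/-- The part of the vector that participant `j` aggregates. -/
def part (R : Round d n) (j : Fin n) : Finset (Fin d) :=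
  splitPart d #R.participants #(R.participants.filter (· < j))

/-- `δ̂_k = b̂_k / (n_k - m)`. -/
def delta (R : Round d n) (m : ℕ) : ℝ := R.numAttack / ((#R.active : ℝ) - m)

/-- `(g_i(j) - v) min {1, τ / ‖g_i(j) - v‖}` for a candidate value `v` of part `j`; the bound on the
pairwise variance of part `j` is `2 d_j σ² / d`, with `d_j` the size of the part. -/
def clippedDiff (R : Round d n) (m : ℕ) (σ : ℝ) (i j : Fin n)
    (v : EuclideanSpace ℝ (R.part j)) : EuclideanSpace ℝ (R.part j) :=
  clip (R.delta m) (2 * #(R.part j) * σ ^ 2 / d) (subvec (R.part j) (R.sent i) - v)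

/-- `v` is a solution of the CenteredClip equation for part `j`. -/
def IsCenteredClip (R : Round d n) (m : ℕ) (σ : ℝ) (j : Fin n)
    (v : EuclideanSpace ℝ (R.part j)) : Prop :=
  ∑ i ∈ R.participants, R.clippedDiff m σ i j v = 0

/-- The metadata that `i` broadcasts about part `j` agree with the vector it committed to. -/
def MetadataOk (R : Round d n) (m : ℕ) (σ : ℝ) (i j : Fin n) : Prop :=
  R.normRep i j = ‖subvec (R.part j) (R.sent i) - subvec (R.part j) R.announced‖ ∧
  R.innerRep i j = inner ℝ (subvec (R.part j) R.dir)
    (R.clippedDiff m σ i j (subvec (R.part j) R.announced))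

/-- Participant `i` follows the protocol: its gradient, the part it aggregates, and all its metadata
are correct. -/
def Follows (R : Round d n) (m : ℕ) (σ : ℝ) (i : Fin n) : Prop :=
  R.sent i = R.grad i ∧
  R.IsCenteredClip m σ i (subvec (R.part i) R.announced) ∧
  ∀ j ∈ R.participants, R.MetadataOk m σ i j

open Classical in
/-- The attackers: the participants that violate the protocol in this iteration. -/
def attackers (R : Round d n) (m : ℕ) (σ : ℝ) : Finset (Fin n) :=
  R.participants.filter fun i => ¬ R.Follows m σ i

/-- The threshold `Δ_max^k = (1 + √3) √2 σ / √(n_k - m)` of the third verification. -/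
def deltaMax (R : Round d n) (m : ℕ) (σ : ℝ) : ℝ :=
  (1 + √3) * √2 * σ / √((#R.active : ℝ) - m)

open Classical in
/-- The aggregation of part `j` is re-run by all peers: the inner products reported for the part do
not sum to zero (second verification), or more than half of the participants report a distance above
`Δ_max` (third verification, CheckAveraging). -/
def Challenged (R : Round d n) (m : ℕ) (σ : ℝ) (j : Fin n) : Prop :=
  ∑ i ∈ R.participants, R.innerRep i j ≠ 0 ∨
  (#R.participants : ℝ) / 2 < #(R.participants.filter fun i => R.deltaMax m σ < R.normRep i j)

/-- The aggregator `j` is challenged and the re-run shows that its part was wrong. -/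
def AggregatorExposed (R : Round d n) (m : ℕ) (σ : ℝ) (j : Fin n) : Prop :=
  R.Challenged m σ j ∧ ¬ R.IsCenteredClip m σ j (subvec (R.part j) R.announced)

/-- A good aggregator finds that the metadata of `i` about its part are wrong (first and second
verification). -/
def MetadataExposed (R : Round d n) (m : ℕ) (σ : ℝ) (byz : Finset (Fin n)) (i : Fin n) : Prop :=
  ∃ j ∈ R.participants, j ∉ byz ∧ ¬ R.MetadataOk m σ i j

open Classical in
/-- The participants banned by the verifications. -/
def exposed (R : Round d n) (m : ℕ) (σ : ℝ) (byz : Finset (Fin n)) : Finset (Fin n) :=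
  R.participants.filter fun i => R.AggregatorExposed m σ i ∨ R.MetadataExposed m σ byz i

/-- `ĝ` is the outcome of BTARD: each part is the announced one, except that a part found to be wrong
by a re-run is replaced by the correct one. -/
def IsOutput (R : Round d n) (m : ℕ) (σ : ℝ) (ghat : Vec d) : Prop :=
  ∀ j ∈ R.participants,
    (R.AggregatorExposed m σ j → R.IsCenteredClip m σ j (subvec (R.part j) ghat)) ∧
    (¬ R.AggregatorExposed m σ j → subvec (R.part j) ghat = subvec (R.part j) R.announced)

end Round

/-! ### BTARD-SGD -/

/-- `γ = min {1 / (4L), √(Δ₀ n / (L σ² K))}`. -/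
def stepSize (L Δ₀ σ : ℝ) (n K : ℕ) : ℝ :=
  min (1 / (4 * L)) (√(Δ₀ * n / (L * σ ^ 2 * K)))

/-- A choice of `2m` distinct peers: the validators `c_1, …, c_m` and the peers `u_1, …, u_m` that
they check, `c_t` checking `u_t`. -/
abbrev Draw (n m : ℕ) : Type := (Fin m ⊕ Fin m) ↪ Fin n

/-- The validators in iteration `k`; `draw k` is made at the end of iteration `k`. -/
def validatorsAt {n m : ℕ} (draw : ℕ → Draw n m) : ℕ → Finset (Fin n)
  | 0 => ∅
  | k + 1 => Finset.univ.image fun t : Fin m => draw k (Sum.inl t)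

open Classical in
/-- CheckComputations after a round: the attackers of this round that are checked by a good
validator. -/
def caught {d n m : ℕ} (byz : Finset (Fin n)) (σ : ℝ) (R : Round d n) (e : Draw n m) :
    Finset (Fin n) :=
  (Finset.univ.filter fun t : Fin m =>
    e (Sum.inl t) ∉ byz ∧ e (Sum.inr t) ∈ R.attackers m σ).image fun t => e (Sum.inr t)

/-- The peers removed at the end of iteration `k` because of the checks of computations of the
previous iteration (these checks are run in parallel with iteration `k`). -/
def caughtBefore {d n m : ℕ} (byz : Finset (Fin n)) (σ : ℝ) (round : ℕ → Round d n)
    (draw : ℕ → Draw n m) : ℕ → Finset (Fin n)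
  | 0 => ∅
  | k + 1 => caught byz σ (round k) (draw k)

/-- `K` iterations of BTARD-SGD on `ℝ^d` with stepsize `γ`, started at `x₀`, as a random process on
`(Ω, μ)`, where the peers in `byz` are controlled by an omniscient adversary. Everything that
the fields leave open is up to the adversary, which may use private randomness. -/
structure BTARDSGD {Ω : Type*} [mΩ : MeasurableSpace Ω] (μ : Measure Ω)
    {Ξ : Type*} [MeasurableSpace Ξ] (D : Measure Ξ) {d n : ℕ} (g : Vec d → Ξ → Vec d)
    (byz : Finset (Fin n)) (m : ℕ) (σ γ : ℝ) (x₀ : Vec d) (K : ℕ) where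
  /-- all that is determined at the start of iteration `k` -/
  past : Filtration ℕ mΩ
  /-- all that is determined in iteration `k` before validators are drawn -/
  mid : ℕ → MeasurableSpace Ω
  past_le_mid : ∀ k < K, past k ≤ mid k
  mid_le_past : ∀ k < K, mid k ≤ past (k + 1)
  /-- the samples of the peers -/
  ξ : ℕ → Ω → Fin n → Ξ
  /-- the iterates -/
  x : ℕ → Ω → Vec d
  round : ℕ → Ω → Round d n
  /-- the results of BTARD -/
  ghat : ℕ → Ω → Vec d
  draw : ℕ → Ω → Draw n m
  /-- the peers removed in iteration `k` through mutual elimination, or because the adversary gives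
  them up -/
  elim : ℕ → Ω → Finset (Fin n)
  -- The samples of an iteration are i.i.d. and independent of the past.
  ξ_meas : ∀ k < K, Measurable[mid k] (ξ k)
  ξ_law : ∀ k < K, μ.map (ξ k) = Measure.pi fun _ : Fin n => D
  ξ_indep : ∀ k < K, Indep (MeasurableSpace.comap (ξ k) inferInstance) (past k) μ
  -- The rounds.
  grad_eq : ∀ k < K, ∀ ω i, (round k ω).grad i = g (x k ω) (ξ k ω i)
  validators_eq : ∀ k < K, ∀ ω, (round k ω).validators = validatorsAt (fun j => draw j ω) k
  dir_unit : ∀ k < K, ∀ ω, ‖(round k ω).dir‖ = 1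
  good_follow : ∀ k < K, ∀ ω, ∀ i ∈ (round k ω).participants, i ∉ byz → (round k ω).Follows m σ i
  -- The number of attackers is exact, and it is known when the iteration starts.
  numAttack_eq : ∀ k < K, ∀ ω, (round k ω).numAttack = #((round k ω).attackers m σ)
  numAttack_meas : ∀ k < K, ∀ j, MeasurableSet[past k] {ω | (round k ω).numAttack = j}
  -- Who attacks may depend on all samples, but not on the validators drawn afterwards.
  attackers_meas : ∀ k < K, ∀ i, MeasurableSet[mid k] {ω | i ∈ (round k ω).attackers m σ}
  ghat_output : ∀ k < K, ∀ ω, (round k ω).IsOutput m σ (ghat k ω)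
  -- The SGD steps.
  x_zero : ∀ ω, x 0 ω = x₀
  x_succ : ∀ k < K, ∀ ω, x (k + 1) ω = x k ω - γ • ghat k ω
  x_meas : ∀ k ≤ K, Measurable[past k] (x k)
  -- The active peers; `(round (k + 1) ω).active` is what remains after iteration `k`.
  active_zero : ∀ ω, (round 0 ω).active = Finset.univ
  active_succ : ∀ k < K, ∀ ω, (round (k + 1) ω).active = (round k ω).active \
    (caughtBefore byz σ (fun j => round j ω) (fun j => draw j ω) k ∪
      (round k ω).exposed m σ byz ∪ elim k ω)
  active_meas : ∀ k < K, ∀ S, MeasurableSet[mid k] {ω | (round (k + 1) ω).active = S}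
  -- Each elimination of a good peer costs the adversary a Byzantine peer.
  elim_sub : ∀ k < K, ∀ ω, elim k ω ⊆ (round k ω).active
  elim_card : ∀ k < K, ∀ ω, #(elim k ω \ byz) ≤ #(elim k ω ∩ byz)
  -- Given all that precedes, the draw is uniform among the remaining peers.
  draw_meas : ∀ k < K, ∀ e, MeasurableSet[past (k + 1)] {ω | draw k ω = e}
  draw_law : ∀ k < K, ∀ A, MeasurableSet[mid k] A → ∀ S : Finset (Fin n), ∀ e : Draw n m,
    (∀ t, e t ∈ S) →
    μ (A ∩ {ω | (round (k + 1) ω).active = S} ∩ {ω | draw k ω = e}) =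
      μ (A ∩ {ω | (round (k + 1) ω).active = S}) / ((#S).descFactorial (2 * m) : ℝ≥0∞)

/-- `E‖∇f(x̄^K)‖²` for `x̄^K` picked uniformly at random from `x^0, …, x^{K-1}`, independently of the
process `x`. -/
def expectedSqGrad {Ω : Type*} [MeasurableSpace Ω] (μ : Measure Ω) {d : ℕ} (f : Vec d → ℝ)
    (x : ℕ → Ω → Vec d) (K : ℕ) : ℝ≥0∞ :=
  ∫⁻ p : Ω × Fin K, ‖gradient f (x p.2 p.1)‖ₑ ^ 2 ∂(μ.prod (uniformOn (Set.univ : Set (Fin K))))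

end

/-! ### Clipping to a ball -/

section BallClip

variable {V : Type*} [NormedAddCommGroup V]

/-! The proof is a descent argument with a budget for attacks. Write `Q` for the participants of an
iteration, `c` for its number of attackers and `G` for the gradient at the iterate. Conditionally on
the past, `Q` and `c` are fixed, and the samples are fresh and i.i.d.

If `c = 0`, nothing is clipped and the output is the mean of the prescribed gradients, so the
ordinary unbiased SGD estimate applies, with noise of order `L γ² σ² / n` (`mean_step`). If `c ≥ 1`,
the output may be biased, and only its squared error is used: `step_le` charges `γ ‖ĝ - G‖²`, whose
mean is of order `γ σ² c / n` (`meanLE_attackBound`). An attacker is banned with probability at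
least `m / (2n)` per attack, up to a delay of one iteration, so the expected total number of attacks
is at most `6 n b / m` (`sum_lintegral_numAttack_le`). Summing over the iterations bounds the mean
squared gradient by a constant times `Δ₀ / (γ K) + L γ σ² / n + σ² b / (m K)`, and the step size
balances the first two terms (`stepSize_bound`).

The delicate point is the error in an attacked iteration, because the adversary sees all samples
before choosing who attacks. The error is therefore bounded pointwise by `attackBound`, which
involves `Q`, `c` and the prescribed gradients of all participants, attackers included, but not the
set of attackers. Its mean is then computed from independence and second moments alone.

Two mechanisms give this bound. In a correctly aggregated part, `v ↦ ∑ clip (z i - v)` is a monotone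
operator, strongly so when most `z i` lie in the half ball, and the attackers change its value by at
most `2 c τ` (`centeredClip_error`). A wrongly aggregated part survives only if at least half of the
participants report a norm of at most `Δ_max`. Hence it is close to many honest inputs, which forces
it to be small unless many of these inputs are large (`norm_sq_le_of_many_close`). At most `c` parts
are of this second kind. -/

lemma ballClip_coeff_mul_norm {τ : ℝ} (hτ : 0 ≤ τ) (y : V) :
    min 1 (τ / ‖y‖) * ‖y‖ = min ‖y‖ τ := by
  rcases eq_or_ne y 0 with rfl | hy
  · simp [hτ]
  · have h : 0 < ‖y‖ := norm_pos_iff.2 hy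
    rw [min_mul_of_nonneg _ _ h.le, one_mul, div_mul_cancel₀ _ h.ne']

variable [InnerProductSpace ℝ V]

/-- `y ↦ y · min {1, τ / ‖y‖}`, the projection onto the ball of radius `τ`. -/
noncomputable def ballClip (τ : ℝ) (y : V) : V := (min 1 (τ / ‖y‖)) • y

lemma norm_ballClip {τ : ℝ} (hτ : 0 ≤ τ) (y : V) : ‖ballClip τ y‖ = min ‖y‖ τ := by
  have h : 0 ≤ min 1 (τ / ‖y‖) := by positivity
  rw [ballClip, norm_smul, Real.norm_of_nonneg h, ballClip_coeff_mul_norm hτ]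

lemma ballClip_of_norm_le {τ : ℝ} {y : V} (h : ‖y‖ ≤ τ) : ballClip τ y = y := by
  rcases eq_or_ne y 0 with rfl | hy
  · simp [ballClip]
  · have h0 : 0 < ‖y‖ := norm_pos_iff.2 hy
    rw [ballClip, min_eq_left ((one_le_div h0).2 h), one_smul]

lemma ballClip_of_le_norm {τ : ℝ} (hτ : 0 < τ) {y : V} (h : τ ≤ ‖y‖) :
    ballClip τ y = (τ / ‖y‖) • y := by
  rw [ballClip, min_eq_right ((div_le_one (hτ.trans_le h)).2 h)]

/-- By Cauchy–Schwarz the inner product is at least `(min ‖a‖ τ - min ‖b‖ τ) (‖a‖ - ‖b‖)`, and `t ↦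
min t τ` is monotone. -/
lemma ballClip_monotone {τ : ℝ} (hτ : 0 ≤ τ) (a b : V) :
    0 ≤ inner ℝ (ballClip τ a - ballClip τ b) (a - b) := by
  have ha := ballClip_coeff_mul_norm hτ a
  have hb := ballClip_coeff_mul_norm hτ b
  have hl : 0 ≤ min 1 (τ / ‖a‖) := by positivity
  have hm : 0 ≤ min 1 (τ / ‖b‖) := by positivity
  simp only [ballClip]
  generalize min 1 (τ / ‖a‖) = l at *
  generalize min 1 (τ / ‖b‖) = r at *
  have e : inner ℝ (l • a - r • b) (a - b) =
      l * ‖a‖ ^ 2 + r * ‖b‖ ^ 2 - (l + r) * inner ℝ a b := by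
    simp only [inner_sub_left, inner_sub_right, real_inner_smul_left, real_inner_self_eq_norm_sq,
      real_inner_comm a b]
    ring
  have h1 := real_inner_le_norm a b
  have h2 : 0 ≤ (min ‖a‖ τ - min ‖b‖ τ) * (‖a‖ - ‖b‖) := by
    rcases le_total ‖a‖ ‖b‖ with h | h
    · exact mul_nonneg_of_nonpos_of_nonpos (sub_nonpos.2 (min_le_min_right _ h)) (sub_nonpos.2 h)
    · exact mul_nonneg (sub_nonneg.2 (min_le_min_right _ h)) (sub_nonneg.2 h)
  rw [e]
  rw [← ha, ← hb] at h2
  nlinarith [mul_le_mul_of_nonneg_left h1 (add_nonneg hl hm)]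

/-- A point `z` of the half ball is not clipped and has a margin `τ / 2` to the sphere. When `z - u`
is clipped by a factor `l`, the relation `l (‖z‖ + ‖u‖) ≥ τ` leaves at least `τ - ‖z‖` along `u`. -/
lemma ballClip_strongly_monotone {τ : ℝ} (hτ : 0 < τ) {z : V} (hz : ‖z‖ ≤ τ / 2) (u : V) :
    ‖u‖ * min ‖u‖ (τ / 2) ≤ inner ℝ (ballClip τ z - ballClip τ (z - u)) u := by
  rw [ballClip_of_norm_le (hz.trans (by linarith))]
  rcases le_total ‖z - u‖ τ with h | h
  · rw [ballClip_of_norm_le h, sub_sub_cancel, real_inner_self_eq_norm_sq, sq]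
    exact mul_le_mul_of_nonneg_left (min_le_left _ _) (norm_nonneg _)
  · rw [ballClip_of_le_norm hτ h]
    have hw : 0 < ‖z - u‖ := hτ.trans_le h
    have hl1 : τ / ‖z - u‖ ≤ 1 := (div_le_one hw).2 h
    have hl0 : 0 ≤ τ / ‖z - u‖ := by positivity
    have hl : τ / ‖z - u‖ * ‖z - u‖ = τ := div_mul_cancel₀ _ hw.ne'
    generalize τ / ‖z - u‖ = l at *
    have e : inner ℝ (z - l • (z - u)) u = (1 - l) * inner ℝ z u + l * ‖u‖ ^ 2 := by
      simp only [inner_sub_left, real_inner_smul_left, real_inner_self_eq_norm_sq]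
      ring
    have h1 : -(‖z‖ * ‖u‖) ≤ inner ℝ z u := by
      have := abs_real_inner_le_norm z u
      exact (abs_le.1 this).1
    have h2 : ‖z - u‖ ≤ ‖z‖ + ‖u‖ := norm_sub_le z u
    have h3 : τ ≤ l * (‖z‖ + ‖u‖) := hl ▸ mul_le_mul_of_nonneg_left h2 hl0
    have h4 : τ / 2 ≤ l * ‖u‖ - (1 - l) * ‖z‖ := by linarith
    have h5 := mul_le_mul_of_nonneg_left h1 (sub_nonneg.2 hl1)
    have h6 := mul_le_mul_of_nonneg_left h4 (norm_nonneg u)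
    have h7 : ‖u‖ * min ‖u‖ (τ / 2) ≤ ‖u‖ * (τ / 2) :=
      mul_le_mul_of_nonneg_left (min_le_right _ _) (norm_nonneg _)
    rw [e]
    nlinarith

/-- The clipped-off length `(‖z‖ - τ)⁺` has both a linear and a quadratic bound. The linear one
serves diagonal terms and the quadratic one off-diagonal terms, so that no moment above the second
is ever needed. -/
lemma norm_sub_ballClip_le {τ : ℝ} (hτ : 0 < τ) (z : V) :
    ‖z - ballClip τ z‖ ≤ ‖z‖ ∧ ‖z - ballClip τ z‖ ≤ ‖z‖ ^ 2 / τ := by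
  rcases le_total ‖z‖ τ with h | h
  · rw [ballClip_of_norm_le h, sub_self, norm_zero]
    exact ⟨norm_nonneg _, by positivity⟩
  · have hz : 0 < ‖z‖ := hτ.trans_le h
    have h1 : ‖z - ballClip τ z‖ ≤ ‖z‖ := by
      have e : z - ballClip τ z = (1 - τ / ‖z‖) • z := by
        rw [ballClip_of_le_norm hτ h, sub_smul, one_smul]
      have h2 : τ / ‖z‖ ≤ 1 := (div_le_one hz).2 h
      have h3 : 0 ≤ τ / ‖z‖ := by positivity
      rw [e, norm_smul, Real.norm_of_nonneg (by linarith)]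
      nlinarith
    refine ⟨h1, h1.trans ?_⟩
    rw [le_div_iff₀ hτ]
    nlinarith

/-- Here `z - u` is clipped and points roughly along `-u`: `‖u‖² - ⟨z, u⟩ ≥ 3/4 ‖u‖²` while `‖z - u‖
≤ 5/4 ‖u‖`, whence the factor `3/5`. -/
lemma inner_ballClip_sub_ge {τ : ℝ} (hτ : 0 < τ) {z u : V} (hu : 4 * τ < ‖u‖)
    (hz : ‖z‖ ≤ ‖u‖ / 4) : 3 / 5 * τ * ‖u‖ ≤ -inner ℝ (ballClip τ (z - u)) u := by
  have h1 : ‖u‖ ≤ ‖z‖ + ‖z - u‖ := by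
    calc ‖u‖ = ‖z - (z - u)‖ := by congr 1; abel
      _ ≤ _ := norm_sub_le _ _
  have h2 : ‖z - u‖ ≤ ‖z‖ + ‖u‖ := norm_sub_le z u
  have hw : τ ≤ ‖z - u‖ := by linarith
  have hw0 : 0 < ‖z - u‖ := hτ.trans_le hw
  rw [ballClip_of_le_norm hτ hw, real_inner_smul_left, inner_sub_left, real_inner_self_eq_norm_sq]
  have h3 : inner ℝ z u ≤ ‖u‖ / 4 * ‖u‖ :=
    (real_inner_le_norm z u).trans (mul_le_mul_of_nonneg_right hz (norm_nonneg _))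
  rw [← mul_neg, neg_sub, div_mul_eq_mul_div τ, le_div_iff₀ hw0]
  have h4 : ‖z - u‖ ≤ 5 / 4 * ‖u‖ := by linarith
  have hu0 : 0 ≤ τ * ‖u‖ := by positivity
  nlinarith [mul_le_mul_of_nonneg_left h4 hu0, mul_le_mul_of_nonneg_left h3 hτ.le]

end BallClip

/-! ### The error of CenteredClip -/

/-- A quarter of the `z i` being large makes the sum of products of squares large. -/
lemma sum_offDiag_ge {ι V : Type*} [DecidableEq ι] [NormedAddCommGroup V] (Q : Finset ι) (z : ι → V)
    {s : ℝ} (hs : 0 ≤ s) (hp : 10 ≤ #Q)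
    (hB : (#Q : ℝ) / 4 ≤ #(Q.filter fun i => s < ‖z i‖)) :
    3 / 80 * (#Q : ℝ) ^ 2 * s ^ 4 ≤ ∑ q ∈ Q.offDiag, ‖z q.1‖ ^ 2 * ‖z q.2‖ ^ 2 := by
  set B := Q.filter fun i => s < ‖z i‖
  have hBQ : B ⊆ Q := filter_subset _ _
  have h1 : ∑ q ∈ B.offDiag, s ^ 4 ≤ ∑ q ∈ Q.offDiag, ‖z q.1‖ ^ 2 * ‖z q.2‖ ^ 2 := by
    refine (sum_le_sum fun q hq => ?_).trans
      (sum_le_sum_of_subset_of_nonneg (offDiag_mono hBQ) fun _ _ _ => by positivity)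
    rw [mem_offDiag] at hq
    have ha := (mem_filter.1 hq.1).2
    have hb := (mem_filter.1 hq.2.1).2
    calc s ^ 4 = s ^ 2 * s ^ 2 := by ring
      _ ≤ _ := by gcongr
  refine le_trans ?_ h1
  have hp' : (10 : ℝ) ≤ #Q := by exact_mod_cast hp
  rw [sum_const, nsmul_eq_mul, offDiag_card, Nat.cast_sub (Nat.le_mul_self _), Nat.cast_mul]
  have h2 : (0 : ℝ) ≤ s ^ 4 := by positivity
  refine mul_le_mul_of_nonneg_right ?_ h2
  -- With `p = #Q`, the inequality `p/4 * (p/4 - 1) ≥ 3/80 * p²` holds exactly when `p ≥ 10`.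
  nlinarith

lemma sq_three_terms_le (S l w : ℝ) :
    (48 * (S + l + 2 * w)) ^ 2 ≤ 27648 * (S ^ 2 + l ^ 2 + w ^ 2) := by
  nlinarith [sq_nonneg (S - l), sq_nonneg (S - 2 * w), sq_nonneg (l - 2 * w), sq_nonneg S,
    sq_nonneg l]

/-- The error of an exact CenteredClip solution when the inputs outside `A` are `z i`. -/
lemma centeredClip_error {ι V : Type*} [DecidableEq ι] [NormedAddCommGroup V]
    [InnerProductSpace ℝ V] (Q A : Finset ι) (hA : A ⊆ Q) (y z : ι → V) (u : V) {τ : ℝ} (hτ : 0 < τ)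
    (hp : 10 ≤ #Q) (hA' : (#A : ℝ) ≤ #Q / 10) (hyz : ∀ i ∈ Q, i ∉ A → y i = z i)
    (hu : ∑ i ∈ Q, ballClip τ (y i - u) = 0) :
    ‖u‖ ^ 2 ≤ 30000 * ((#A / #Q) ^ 2 * τ ^ 2 + ‖∑ i ∈ Q, z i‖ ^ 2 / #Q ^ 2 +
      (∑ i ∈ Q, ‖z i‖ ^ 2) / #Q ^ 2 +
      (∑ q ∈ Q.offDiag, ‖z q.1‖ ^ 2 * ‖z q.2‖ ^ 2) / (#Q ^ 2 * τ ^ 2)) := by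
  have hp' : (10 : ℝ) ≤ #Q := by exact_mod_cast hp
  have hp0 : (0 : ℝ) < #Q := by linarith
  set p : ℝ := ((#Q : ℕ) : ℝ) with hpdef
  set a : ℝ := ((#A : ℕ) : ℝ) with hadef
  have ha0 : 0 ≤ a := by positivity
  set X := ∑ q ∈ Q.offDiag, ‖z q.1‖ ^ 2 * ‖z q.2‖ ^ 2 with hX
  have hX0 : 0 ≤ X := sum_nonneg fun _ _ => by positivity
  set e := ∑ i ∈ Q, ballClip τ (z i - u) with he
  have hsmall : ∀ s : ℝ, 0 ≤ s → τ / 2 ≤ s → ‖u‖ ≤ 8 * s →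
      p / 4 ≤ #(Q.filter fun i => s < ‖z i‖) → ‖u‖ ^ 2 ≤ 30000 * (X / (p ^ 2 * τ ^ 2)) := by
    -- The two exceptional cases below both end here: if a quarter of the inputs exceed some `s`
    -- comparable to `‖u‖`, then the off-diagonal sum `X` alone pays for `‖u‖²`.
    intro s hs hs2 hus hB
    have h1 := sum_offDiag_ge Q z hs hp hB
    rw [← hX, ← hpdef] at h1
    have h2 : ‖u‖ ^ 2 ≤ 64 * s ^ 2 := by nlinarith [norm_nonneg u]
    have h3 : 3 / 320 * s ^ 2 ≤ X / (p ^ 2 * τ ^ 2) := by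
      rw [le_div_iff₀ (by positivity)]
      have : τ ^ 2 ≤ 4 * s ^ 2 := by nlinarith
      calc 3 / 320 * s ^ 2 * (p ^ 2 * τ ^ 2) ≤ 3 / 320 * s ^ 2 * (p ^ 2 * (4 * s ^ 2)) := by gcongr
        _ = 3 / 80 * p ^ 2 * s ^ 4 := by ring
        _ ≤ X := h1
    nlinarith
  have hnn1 : 0 ≤ (a / p) ^ 2 * τ ^ 2 := by positivity
  have hnn2 : 0 ≤ ‖∑ i ∈ Q, z i‖ ^ 2 / p ^ 2 := by positivity
  have hnn3 : 0 ≤ (∑ i ∈ Q, ‖z i‖ ^ 2) / p ^ 2 := by positivity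
  have hnn4 : 0 ≤ X / (p ^ 2 * τ ^ 2) := by positivity
  -- `e` is the operator for the prescribed inputs `z`, evaluated at the point `u` that solves the
  -- equation for the actual inputs `y`. Only attackers contribute, each at most `2τ`.
  have heA : e = ∑ i ∈ A, (ballClip τ (z i - u) - ballClip τ (y i - u)) := by
    have h1 : e = ∑ i ∈ Q, (ballClip τ (z i - u) - ballClip τ (y i - u)) := by
      rw [sum_sub_distrib, hu, sub_zero]
    rw [h1]
    refine (sum_subset hA fun i hi hiA => ?_).symm
    rw [hyz i hi hiA, sub_self]
  have hen : ‖e‖ ≤ 2 * a * τ := by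
    rw [heA]
    refine (norm_sum_le _ _).trans ((sum_le_sum (g := fun _ => 2 * τ) fun i _ => ?_).trans ?_)
    · refine (norm_sub_le _ _).trans ?_
      rw [norm_ballClip hτ.le, norm_ballClip hτ.le]
      linarith [min_le_right ‖z i - u‖ τ, min_le_right ‖y i - u‖ τ]
    · rw [sum_const, nsmul_eq_mul]; linarith
  by_cases hu4 : 4 * τ < ‖u‖
  -- Far solution: testing `e` against `u`, an input of norm at most `‖u‖ / 4` contributes at least
  -- `3/5 τ ‖u‖` and any other at least `-τ ‖u‖`. The total is at most `2 a τ ‖u‖ ≤ p/5 τ ‖u‖`,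
  -- which forces a quarter of the inputs to be large.
  · have hB : p / 4 ≤ #(Q.filter fun i => ‖u‖ / 4 < ‖z i‖) := by
      set B := Q.filter fun i => ‖u‖ / 4 < ‖z i‖
      have h1 : -inner ℝ e u = ∑ i ∈ Q, -inner ℝ (ballClip τ (z i - u)) u := by
        rw [he, sum_inner, sum_neg_distrib]
      have h2 : ∀ i ∈ Q, (3 / 5 * τ * ‖u‖ - if ‖u‖ / 4 < ‖z i‖ then 8 / 5 * τ * ‖u‖ else 0) ≤
          -inner ℝ (ballClip τ (z i - u)) u := by
        intro i _
        split_ifs with h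
        · have := real_inner_le_norm (ballClip τ (z i - u)) u
          rw [norm_ballClip hτ.le] at this
          nlinarith [min_le_right ‖z i - u‖ τ, norm_nonneg u]
        · rw [sub_zero]; exact inner_ballClip_sub_ge hτ hu4 (not_lt.1 h)
      have h3 := sum_le_sum h2
      rw [← h1, sum_sub_distrib, sum_const, nsmul_eq_mul, ← sum_filter, sum_const,
        nsmul_eq_mul] at h3
      have h4 : -inner ℝ e u ≤ 2 * a * τ * ‖u‖ := by
        have := (abs_le.1 (abs_real_inner_le_norm e u)).1
        nlinarith [norm_nonneg u]
      have h5 : 0 < τ * ‖u‖ := mul_pos hτ (by linarith)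
      have h6 : (p * (3 / 5) - #B * (8 / 5) - 2 * a) * (τ * ‖u‖) ≤ 0 := by
        have := h3.trans h4
        nlinarith
      have h7 : p * (3 / 5) - #B * (8 / 5) - 2 * a ≤ 0 := by
        by_contra! h
        exact absurd h6 (not_le.2 (mul_pos h h5))
      linarith
    have := hsmall (‖u‖ / 4) (by positivity) (by linarith) (by linarith [norm_nonneg u]) hB
    linarith
  rw [not_lt] at hu4
  by_cases hB : p / 4 ≤ #(Q.filter fun i => τ / 2 < ‖z i‖)
  · have := hsmall (τ / 2) (by positivity) le_rfl (by linarith) hB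
    linarith
  rw [not_le] at hB
  set c := ∑ i ∈ Q, ballClip τ (z i) with hc
  -- The operator takes the values `c` at `0` and `e` at `u`. More than three quarters of its
  -- summands are strongly monotone there, and the remaining ones are at least monotone.
  have hmain : 3 / 4 * p * min ‖u‖ (τ / 2) ≤ ‖c‖ + 2 * a * τ := by
    rcases (norm_nonneg u).eq_or_lt with h0 | h0
    · have h1 : 0 ≤ ‖c‖ + 2 * a * τ := by positivity
      rwa [← h0, min_eq_left (by positivity), mul_zero]
    have h1 : ∀ i ∈ Q, (if τ / 2 < ‖z i‖ then 0 else ‖u‖ * min ‖u‖ (τ / 2)) ≤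
        inner ℝ (ballClip τ (z i) - ballClip τ (z i - u)) u := by
      intro i _
      split_ifs with h
      · have := ballClip_monotone hτ.le (z i) (z i - u)
        rwa [sub_sub_cancel] at this
      · exact ballClip_strongly_monotone hτ (not_lt.1 h) u
    have h2 := sum_le_sum h1
    rw [← sum_inner, sum_sub_distrib, ← hc, ← he, sum_ite, sum_const_zero, zero_add, sum_const,
      nsmul_eq_mul] at h2
    have h3 : (#(Q.filter fun i => τ / 2 < ‖z i‖) : ℝ) +
        #(Q.filter fun i => ¬ τ / 2 < ‖z i‖) = p := by
      rw [hpdef]; exact_mod_cast card_filter_add_card_filter_not _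
    have h4 : inner ℝ (c - e) u ≤ (‖c‖ + 2 * a * τ) * ‖u‖ :=
      (real_inner_le_norm _ _).trans (mul_le_mul_of_nonneg_right
        ((norm_sub_le _ _).trans (by linarith)) (norm_nonneg _))
    have h5 : 0 ≤ ‖u‖ * min ‖u‖ (τ / 2) := by positivity
    have h6 : 3 / 4 * p * (‖u‖ * min ‖u‖ (τ / 2)) ≤ (‖c‖ + 2 * a * τ) * ‖u‖ := by
      refine le_trans ?_ (h2.trans h4)
      exact mul_le_mul_of_nonneg_right (by linarith) h5
    refine le_of_mul_le_mul_right ?_ h0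
    linarith
  have hu2 : ‖u‖ ≤ 48 * (‖c‖ + 2 * a * τ) / p := by
    rw [le_div_iff₀ hp0]
    rcases le_total ‖u‖ (τ / 2) with h | h
    · rw [min_eq_left h] at hmain
      nlinarith [norm_nonneg u, norm_nonneg c, mul_nonneg ha0 hτ.le]
    · rw [min_eq_right h] at hmain
      have h1 : a * τ ≤ p / 10 * τ := mul_le_mul_of_nonneg_right hA' hτ.le
      have h2 : ‖u‖ * p ≤ 4 * τ * p := mul_le_mul_of_nonneg_right hu4 hp0.le
      nlinarith [norm_nonneg c, mul_nonneg ha0 hτ.le]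
  have hcl : ‖c‖ ≤ ‖∑ i ∈ Q, z i‖ + ∑ i ∈ Q, ‖z i - ballClip τ (z i)‖ := by
    have : c = ∑ i ∈ Q, z i - ∑ i ∈ Q, (z i - ballClip τ (z i)) := by
      rw [sum_sub_distrib, sub_sub_cancel]
    rw [this]
    exact (norm_sub_le _ _).trans (by gcongr; exact norm_sum_le _ _)
  -- Expanding the square and using the linear bound on the diagonal and the quadratic one off it
  -- leaves only products of squares with distinct indices, whose means factor.
  have hl2 : (∑ i ∈ Q, ‖z i - ballClip τ (z i)‖) ^ 2 ≤ ∑ i ∈ Q, ‖z i‖ ^ 2 + X / τ ^ 2 := by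
    rw [sq, sum_mul_sum, ← sum_product', ← diag_union_offDiag,
      sum_union (disjoint_diag_offDiag _), sum_diag, hX, sum_div]
    gcongr with i hi q hq
    · rw [← sq]; gcongr; exact (norm_sub_ballClip_le hτ _).1
    · calc _ ≤ (‖z q.1‖ ^ 2 / τ) * (‖z q.2‖ ^ 2 / τ) := by
            gcongr
            · exact (norm_sub_ballClip_le hτ _).2
            · exact (norm_sub_ballClip_le hτ _).2
        _ = _ := by field_simp
  set l := ∑ i ∈ Q, ‖z i - ballClip τ (z i)‖
  have hl0 : 0 ≤ l := sum_nonneg fun _ _ => norm_nonneg _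
  have h1 : ‖u‖ ^ 2 ≤ (48 * (‖∑ i ∈ Q, z i‖ + l + 2 * a * τ) / p) ^ 2 := by
    refine pow_le_pow_left₀ (norm_nonneg _) (hu2.trans ?_) 2
    gcongr
  refine h1.trans ?_
  have h2 : X / (p ^ 2 * τ ^ 2) = X / τ ^ 2 / p ^ 2 := by field_simp
  have h3 : (a / p) ^ 2 * τ ^ 2 = (a * τ) ^ 2 / p ^ 2 := by field_simp
  rw [h2, h3, div_pow, ← add_div, ← add_div, ← add_div, mul_div_assoc']
  gcongr
  have hcs := sq_three_terms_le ‖∑ i ∈ Q, z i‖ l (a * τ)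
  rw [← mul_assoc] at hcs
  linarith only [hcs, hl2, sq_nonneg (a * τ), sq_nonneg ‖∑ i ∈ Q, z i‖, sq_nonneg l]

/-! ### Splitting a vector into parts -/

section Split

variable {d : ℕ}

lemma subvec_sub (S : Finset (Fin d)) (v w : Vec d) :
    subvec S (v - w) = subvec S v - subvec S w := rfl

lemma norm_sq_subvec (S : Finset (Fin d)) (v : Vec d) : ‖subvec S v‖ ^ 2 = ∑ c ∈ S, v c ^ 2 := by
  rw [EuclideanSpace.real_norm_sq_eq, ← sum_coe_sort S]
  rfl

lemma subvec_sum {ι : Type*} (S : Finset (Fin d)) (Q : Finset ι) (v : ι → Vec d) :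
    subvec S (∑ i ∈ Q, v i) = ∑ i ∈ Q, subvec S (v i) := by
  ext c
  simp [subvec]

/-- The number of smaller elements is the rank of `j` in `Q`, and ranks enumerate `range #Q`. This
turns sums over aggregators into sums over consecutive parts. -/
lemma sum_card_filter_lt {n : ℕ} (F : ℕ → ℝ) (Q : Finset (Fin n)) :
    ∑ j ∈ Q, F #(Q.filter (· < j)) = ∑ t ∈ range #Q, F t := by
  induction Q using Finset.induction_on_max with
  | empty => simp
  | insert a s h ih =>
    have ha : a ∉ s := fun h' => lt_irrefl a (h a h')
    rw [sum_insert ha, card_insert_of_notMem ha, sum_range_succ, ← ih, add_comm]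
    congr 1
    · refine sum_congr rfl fun j hj => ?_
      rw [filter_insert, if_neg (not_lt.2 (h j hj).le)]
    · rw [filter_insert, if_neg (lt_irrefl a), filter_true_of_mem h]

lemma splitStart_mono (d a : ℕ) : Monotone (splitStart d a) := fun i j h => by
  unfold splitStart
  gcongr

lemma splitStart_self (d : ℕ) {a : ℕ} (ha : 0 < a) : splitStart d a a = d := by
  unfold splitStart
  rw [min_eq_right (Nat.mod_lt d ha).le]
  exact Nat.div_add_mod d a

lemma sum_splitPart (d a : ℕ) (w : Fin d → ℝ) (p : ℕ) :
    ∑ t ∈ range p, ∑ c ∈ splitPart d a t, w c =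
      ∑ c ∈ univ.filter (fun c : Fin d => (c : ℕ) < splitStart d a p), w c := by
  induction p with
  | zero => simp [splitStart]
  | succ p ih =>
    rw [sum_range_succ, ih, ← sum_union]
    · refine sum_congr ?_ fun _ _ => rfl
      ext c
      have : splitStart d a p ≤ splitStart d a (p + 1) := splitStart_mono d a p.le_succ
      simp only [splitPart, mem_union, mem_filter, mem_univ, true_and]
      omega
    · rw [disjoint_left]
      intro c
      simp only [splitPart, mem_filter, mem_univ, true_and]
      omega

lemma sum_norm_sq_subvec_splitPart {n : ℕ} (Q : Finset (Fin n)) (hQ : 0 < #Q) (w : Vec d) :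
    ∑ j ∈ Q, ‖subvec (splitPart d #Q #(Q.filter (· < j))) w‖ ^ 2 = ‖w‖ ^ 2 := by
  simp only [norm_sq_subvec]
  rw [sum_card_filter_lt (fun t => ∑ c ∈ splitPart d #Q t, w c ^ 2), sum_splitPart,
    splitStart_self d hQ, EuclideanSpace.real_norm_sq_eq, filter_true_of_mem fun c _ => c.2]

lemma sum_card_splitPart {n : ℕ} (Q : Finset (Fin n)) (hQ : 0 < #Q) :
    ∑ j ∈ Q, (#(splitPart d #Q #(Q.filter (· < j))) : ℝ) = d := by
  have h := sum_splitPart d #Q (fun _ => 1) #Q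
  rw [splitStart_self d hQ, filter_true_of_mem fun c _ => c.2] at h
  simp only [sum_const, nsmul_eq_mul, mul_one, card_univ, Fintype.card_fin] at h
  rw [sum_card_filter_lt (fun t => (#(splitPart d #Q t) : ℝ)), h]

lemma card_splitPart {a j : ℕ} (hj : j < a) :
    #(splitPart d a j) = splitStart d a (j + 1) - splitStart d a j := by
  have h : splitStart d a (j + 1) ≤ d := by
    conv_rhs => rw [← splitStart_self d (Nat.zero_lt_of_lt hj)]
    exact splitStart_mono d a hj
  rw [← Nat.card_Ico, ← card_map Fin.valEmbedding]
  congr 1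
  ext c
  simp only [splitPart, mem_map, mem_filter, mem_univ, true_and, Fin.valEmbedding_apply, mem_Ico]
  constructor
  · rintro ⟨c, hc, rfl⟩; exact hc
  · intro hc; exact ⟨⟨c, hc.2.trans_le h⟩, hc, rfl⟩

lemma div_le_card_splitPart {a j : ℕ} (hj : j < a) : d / a ≤ #(splitPart d a j) := by
  rw [card_splitPart hj]
  unfold splitStart
  have : min j (d % a) ≤ min (j + 1) (d % a) := min_le_min_right _ j.le_succ
  rw [add_one_mul]
  generalize d / a = q at *
  generalize d % a = r at *
  generalize j * q = s at *
  omega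

lemma card_splitPart_le {a j : ℕ} (hj : j < a) : #(splitPart d a j) ≤ d / a + 1 := by
  rw [card_splitPart hj]
  unfold splitStart
  have : min (j + 1) (d % a) ≤ min j (d % a) + 1 := by omega
  rw [add_one_mul]
  generalize d / a = q at *
  generalize d % a = r at *
  generalize j * q = s at *
  omega

lemma card_filter_lt_lt_card {n : ℕ} {Q : Finset (Fin n)} {j : Fin n} (hj : j ∈ Q) :
    #(Q.filter (· < j)) < #Q :=
  card_lt_card (filter_ssubset.2 ⟨j, hj, lt_irrefl j⟩)

end Split

/-! ### The aggregation error of one round -/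

/-- The bound of `centeredClip_error`. -/
noncomputable def clipBound {ι V : Type*} [DecidableEq ι] [NormedAddCommGroup V] (Q : Finset ι)
    (c : ℕ) (τ : ℝ) (z : ι → V) : ℝ :=
  30000 * (((c : ℝ) / #Q) ^ 2 * τ ^ 2 + ‖∑ i ∈ Q, z i‖ ^ 2 / #Q ^ 2 +
    (∑ i ∈ Q, ‖z i‖ ^ 2) / #Q ^ 2 +
    (∑ q ∈ Q.offDiag, ‖z q.1‖ ^ 2 * ‖z q.2‖ ^ 2) / (#Q ^ 2 * τ ^ 2))

/-- `1` if a large part of the inputs other than `i` exceeds `s`, and `0` otherwise. -/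
noncomputable def manyLarge {ι V : Type*} [DecidableEq ι] [NormedAddCommGroup V] (Q : Finset ι)
    (s : ℝ) (z : ι → V) (i : ι) : ℝ :=
  if 3 / 10 * (#Q : ℝ) ≤ ∑ l ∈ Q.erase i, (if s < ‖z l‖ then 1 else 0) then 1 else 0

/-- Bounds the squared distance of a point to `0` when it is close to many of the `z i`. -/
noncomputable def tailBound {ι V : Type*} [DecidableEq ι] [NormedAddCommGroup V] (Q : Finset ι)
    (s : ℝ) (z : ι → V) : ℝ :=
  4 / (#Q : ℝ) * ∑ i ∈ Q, ‖z i‖ ^ 2 * manyLarge Q s z i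

lemma clipBound_nonneg {ι V : Type*} [DecidableEq ι] [NormedAddCommGroup V] (Q : Finset ι) (c : ℕ)
    (τ : ℝ) (z : ι → V) : 0 ≤ clipBound Q c τ z := by
  unfold clipBound
  have := sum_nonneg (s := Q.offDiag) (f := fun q => ‖z q.1‖ ^ 2 * ‖z q.2‖ ^ 2)
    fun _ _ => by positivity
  positivity

lemma manyLarge_nonneg {ι V : Type*} [DecidableEq ι] [NormedAddCommGroup V] (Q : Finset ι) (s : ℝ)
    (z : ι → V) (i : ι) : 0 ≤ manyLarge Q s z i := by
  unfold manyLarge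
  split_ifs <;> norm_num

lemma tailBound_nonneg {ι V : Type*} [DecidableEq ι] [NormedAddCommGroup V] (Q : Finset ι) (s : ℝ)
    (z : ι → V) : 0 ≤ tailBound Q s z :=
  mul_nonneg (by positivity) (sum_nonneg fun i _ => mul_nonneg (by positivity)
    (manyLarge_nonneg Q s z i))

/-- If `‖u‖ > 5Δ`, every `z i` close to `u` has norm at least `4/5 ‖u‖ > 4Δ`. There are at least
`2/5 #Q` of these, so each sees at least `2/5 #Q - 1 ≥ 3/10 #Q` other large ones and is counted by
`manyLarge`. The factor `4` in `tailBound` suffices since `4 * 2/5 * 16/25 > 1`. -/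
lemma norm_sq_le_of_many_close {ι V : Type*} [DecidableEq ι] [NormedAddCommGroup V]
    (Q M : Finset ι) (hM : M ⊆ Q) (z : ι → V) (u : V) {Δ : ℝ} (hΔ : 0 ≤ Δ) (hp : 10 ≤ #Q)
    (hcard : 2 / 5 * (#Q : ℝ) ≤ #M) (hclose : ∀ i ∈ M, ‖z i - u‖ ≤ Δ) :
    ‖u‖ ^ 2 ≤ 25 * Δ ^ 2 + tailBound Q (4 * Δ) z := by
  have hp' : (10 : ℝ) ≤ #Q := by exact_mod_cast hp
  rcases le_or_gt ‖u‖ (5 * Δ) with h | h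
  · have h1 := tailBound_nonneg Q (4 * Δ) z
    nlinarith [norm_nonneg u]
  · have hbig : ∀ i ∈ M, 4 / 5 * ‖u‖ ≤ ‖z i‖ ∧ 4 * Δ < ‖z i‖ := by
      intro i hi
      have h1 : ‖u‖ ≤ ‖z i‖ + ‖z i - u‖ := by
        calc ‖u‖ = ‖z i - (z i - u)‖ := by congr 1; abel
          _ ≤ _ := norm_sub_le _ _
      have h2 := hclose i hi
      constructor <;> linarith
    have hone : ∀ i ∈ M, manyLarge Q (4 * Δ) z i = 1 := by
      intro i hi
      refine if_pos ?_
      have h1 : (∑ l ∈ M.erase i, (1 : ℝ)) ≤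
          ∑ l ∈ Q.erase i, (if 4 * Δ < ‖z l‖ then 1 else 0) := by
        refine (sum_le_sum fun l hl => ?_).trans
          (sum_le_sum_of_subset_of_nonneg (erase_subset_erase i hM) fun l _ _ => ?_)
        · rw [if_pos (hbig l (mem_of_mem_erase hl)).2]
        · split_ifs <;> norm_num
      refine le_trans ?_ h1
      rw [sum_const, nsmul_eq_mul, mul_one, card_erase_of_mem hi,
        Nat.cast_sub (card_pos.2 ⟨i, hi⟩), Nat.cast_one]
      linarith
    have h1 : #M * (16 / 25 * ‖u‖ ^ 2) ≤ ∑ i ∈ Q, ‖z i‖ ^ 2 * manyLarge Q (4 * Δ) z i := by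
      rw [← nsmul_eq_mul, ← sum_const]
      refine (sum_le_sum fun i hi => ?_).trans (sum_le_sum_of_subset_of_nonneg hM fun i _ _ =>
        mul_nonneg (by positivity) (manyLarge_nonneg _ _ _ _))
      rw [hone i hi, mul_one]
      nlinarith [(hbig i hi).1, norm_nonneg u]
    have h2 : ‖u‖ ^ 2 ≤ tailBound Q (4 * Δ) z := by
      rw [tailBound, div_mul_eq_mul_div, le_div_iff₀ (by linarith)]
      nlinarith [sq_nonneg ‖u‖]
    nlinarith [sq_nonneg Δ]

lemma clip_eq_ballClip {V : Type*} [NormedAddCommGroup V] [NormedSpace ℝ V] {δ : ℝ} (hδ : δ ≠ 0)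
    (v : ℝ) (y : V) : clip δ v y = (min 1 (clipRadius δ v / ‖y‖)) • y := by
  rw [clip, if_neg hδ]

/-- The error analysis needs only that `τ²` is of order `v / δ`. For `δ ≤ 0.1` the quantity `B²`
lies between `5 v` and `19.5 v`, and `16 * (19.5 / 3 + 1) = 120`. -/
lemma clipRadius_sq {δ v : ℝ} (hδ : 0 < δ) (hδ1 : δ ≤ 0.1) (hv : 0 < v) :
    0 < clipRadius δ v ∧ v / δ ≤ clipRadius δ v ^ 2 ∧ clipRadius δ v ^ 2 ≤ 120 * (v / δ) := by
  have h3 : (1 : ℝ) ≤ √3 := by rw [Real.one_le_sqrt]; norm_num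
  have h3' : √3 ≤ 2 := by rw [Real.sqrt_le_left (by norm_num)]; norm_num
  have hpos : 0 < 1 - 6.45 * δ := by linarith
  have hB1 : 5 * v ≤ 5 * v / (1 - 6.45 * δ) := by
    rw [le_div_iff₀ hpos]; nlinarith
  have hB2 : 5 * v / (1 - 6.45 * δ) ≤ 19.5 * v := by
    rw [div_le_iff₀ hpos]; nlinarith
  set W := 5 * v / (1 - 6.45 * δ)
  have hX : clipRadius δ v ^ 2 = 16 * ((1 - δ) * (W / 3 + v) / (√3 * δ)) := by
    rw [clipRadius, mul_pow, Real.sq_sqrt]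
    · congr 1
      norm_num1
    · have : 0 ≤ W / 3 + v := by linarith
      have : 0 ≤ 1 - δ := by linarith
      positivity
  have hd : 0 < √3 * δ := by positivity
  have h1 : v / δ ≤ 16 * ((1 - δ) * (W / 3 + v) / (√3 * δ)) := by
    have : v / δ = √3 * v / (√3 * δ) := by field_simp
    rw [this, mul_div_assoc']
    gcongr ?_ / _
    have h4 : √3 * v ≤ 2 * v := by nlinarith
    have h5 : 9 / 10 * (8 / 3 * v) ≤ (1 - δ) * (W / 3 + v) := by
      apply mul_le_mul <;> linarith
    linarith
  refine ⟨?_, hX ▸ h1, ?_⟩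
  · have h0 : 0 < clipRadius δ v ^ 2 := by rw [hX]; exact lt_of_lt_of_le (by positivity) h1
    have hn : 0 ≤ clipRadius δ v := by unfold clipRadius; positivity
    exact lt_of_le_of_ne hn fun h => by rw [← h] at h0; norm_num at h0
  · rw [hX, mul_div_assoc', mul_div_assoc']
    rw [div_le_div_iff₀ hd hδ]
    have : 16 * ((1 - δ) * (W / 3 + v)) ≤ 120 * v := by nlinarith
    nlinarith [mul_le_mul_of_nonneg_right this hδ.le, mul_pos hv hδ]

namespace Round

variable {d n : ℕ}

lemma mem_attackers {R : Round d n} {m : ℕ} {σ : ℝ} {i : Fin n} :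
    i ∈ R.attackers m σ ↔ i ∈ R.participants ∧ ¬ R.Follows m σ i := by
  simp [attackers]

/-- The clipping radius of part `j`. -/
noncomputable def radius (R : Round d n) (m : ℕ) (σ : ℝ) (j : Fin n) : ℝ :=
  clipRadius (R.delta m) (2 * #(R.part j) * σ ^ 2 / d)

/-- The first two terms are charged to every part and depend on the attackers only through their
number, since which parts are corrupted may depend on the samples. The term `25 Δ_max²` is charged
only to parts whose aggregator attacks. -/
lemma part_error (R : Round d n) {m : ℕ} {σ : ℝ} {ghat G : Vec d} (hout : R.IsOutput m σ ghat)
    (hσ : 0 ≤ σ)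
    (hcount : R.numAttack = #(R.attackers m σ)) (hδ : R.delta m ≠ 0) (hp : 10 ≤ #R.participants)
    (hc : (R.numAttack : ℝ) ≤ #R.participants / 10) {j : Fin n} (hj : j ∈ R.participants)
    (hτ : 0 < R.radius m σ j) :
    ‖subvec (R.part j) (ghat - G)‖ ^ 2 ≤
      clipBound R.participants R.numAttack (R.radius m σ j)
        (fun i => subvec (R.part j) (R.grad i - G)) +
      tailBound R.participants (4 * R.deltaMax m σ) (fun i => subvec (R.part j) (R.grad i - G)) +
      (if j ∈ R.attackers m σ then 25 * R.deltaMax m σ ^ 2 else 0) := by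
  classical
  have hp' : (10 : ℝ) ≤ #R.participants := by exact_mod_cast hp
  have hΔ : 0 ≤ R.deltaMax m σ := by unfold deltaMax; positivity
  have hnot : ∀ i ∈ R.participants, i ∉ R.attackers m σ → R.Follows m σ i := by
    intro i hi hia
    by_contra h
    exact hia (mem_attackers.2 ⟨hi, h⟩)
  have hcb := clipBound_nonneg R.participants R.numAttack (R.radius m σ j)
    (fun i => subvec (R.part j) (R.grad i - G))
  have htb := tailBound_nonneg R.participants (4 * R.deltaMax m σ)
    (fun i => subvec (R.part j) (R.grad i - G))
  have hite : 0 ≤ (if j ∈ R.attackers m σ then 25 * R.deltaMax m σ ^ 2 else 0) := by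
    split_ifs <;> positivity
  rw [hcount] at hc
  -- The split is on the final part. If it is not a CenteredClip solution, then its aggregator is an
  -- attacker that was never challenged, so at most half of the reported norms exceed `Δ_max`.
  by_cases hcc : R.IsCenteredClip m σ j (subvec (R.part j) ghat)
  · have h := centeredClip_error R.participants (R.attackers m σ) (filter_subset _ _)
      (fun i => subvec (R.part j) (R.sent i - G)) (fun i => subvec (R.part j) (R.grad i - G))
      (subvec (R.part j) (ghat - G)) hτ hp hc
      (fun i hi hia => by rw [(hnot i hi hia).1])
      (by
        rw [← hcc]
        refine sum_congr rfl fun i _ => ?_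
        rw [clippedDiff, clip_eq_ballClip hδ, subvec_sub, subvec_sub, sub_sub_sub_cancel_right]
        rfl)
    rw [← hcount] at h
    change _ ≤ clipBound R.participants R.numAttack (R.radius m σ j)
      (fun i => subvec (R.part j) (R.grad i - G)) at h
    linarith
  · have hexp : ¬ R.AggregatorExposed m σ j := fun h => hcc ((hout j hj).1 h)
    have hann := (hout j hj).2 hexp
    have hch : ¬ R.Challenged m σ j := by
      intro h
      refine hexp ⟨h, ?_⟩
      rwa [← hann]
    have hja : j ∈ R.attackers m σ := by
      by_contra h
      have := (hnot j hj h).2.1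
      rw [← hann] at this
      exact hcc this
    rw [if_pos hja]
    have hfew : (#(R.participants.filter fun i => R.deltaMax m σ < R.normRep i j) : ℝ) ≤
        #R.participants / 2 := by
      by_contra h
      exact hch (Or.inr (not_le.1 h))
    have h := norm_sq_le_of_many_close R.participants
      ((R.participants.filter fun i => ¬ R.deltaMax m σ < R.normRep i j) \ R.attackers m σ)
      (sdiff_subset.trans (filter_subset _ _))
      (fun i => subvec (R.part j) (R.grad i - G)) (subvec (R.part j) (ghat - G)) hΔ hp
      (by
        -- At least half of the participants report a small norm and at most a tenth attack, which
        -- leaves `2/5` with truthful small norms.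
        have h1 : (#(R.participants.filter fun i => R.deltaMax m σ < R.normRep i j) : ℝ) +
            #(R.participants.filter fun i => ¬ R.deltaMax m σ < R.normRep i j) =
            #R.participants := by
          exact_mod_cast card_filter_add_card_filter_not _
        have h2 : (#(R.participants.filter fun i => ¬ R.deltaMax m σ < R.normRep i j) : ℝ) ≤
            #((R.participants.filter fun i => ¬ R.deltaMax m σ < R.normRep i j) \
              R.attackers m σ) + #(R.attackers m σ) := by
          exact_mod_cast card_le_card_sdiff_add_card
        linarith)
      (by
        intro i hi
        rw [mem_sdiff, mem_filter] at hi
        obtain ⟨⟨hiP, hir⟩, hia⟩ := hi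
        have hf := hnot i hiP hia
        rw [subvec_sub, subvec_sub, sub_sub_sub_cancel_right, hann, ← hf.1, ← (hf.2.2 j hj).1]
        exact not_lt.1 hir)
    linarith

lemma error_le (R : Round d n) {m : ℕ} {σ : ℝ} {ghat G : Vec d} (hout : R.IsOutput m σ ghat)
    (hσ : 0 ≤ σ)
    (hcount : R.numAttack = #(R.attackers m σ)) (hδ : R.delta m ≠ 0) (hp : 10 ≤ #R.participants)
    (hc : (R.numAttack : ℝ) ≤ #R.participants / 10)
    (hτ : ∀ j ∈ R.participants, 0 < R.radius m σ j) :
    ‖ghat - G‖ ^ 2 ≤ ∑ j ∈ R.participants,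
      (clipBound R.participants R.numAttack (R.radius m σ j)
        (fun i => subvec (R.part j) (R.grad i - G)) +
      tailBound R.participants (4 * R.deltaMax m σ) (fun i => subvec (R.part j) (R.grad i - G))) +
      R.numAttack * (25 * R.deltaMax m σ ^ 2) := by
  classical
  have h := sum_le_sum fun j hj => R.part_error (G := G) hout hσ hcount hδ hp hc hj (hτ j hj)
  rw [sum_add_distrib, ← sum_filter, sum_const, nsmul_eq_mul] at h
  have h1 : R.participants.filter (· ∈ R.attackers m σ) = R.attackers m σ := by
    ext i
    simp only [mem_filter, and_iff_right_iff_imp]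
    exact fun hi => (mem_attackers.1 hi).1
  rw [h1, ← hcount] at h
  refine le_trans (le_of_eq ?_) h
  exact (sum_norm_sq_subvec_splitPart R.participants (by omega) (ghat - G)).symm

/-- Without attackers `δ̂ = 0`, so nothing is clipped and the CenteredClip equation of each part is
linear with the mean as its only solution. -/
lemma ghat_eq_mean (R : Round d n) {m : ℕ} {σ : ℝ} {ghat : Vec d} (hout : R.IsOutput m σ ghat)
    (hcount : R.numAttack = #(R.attackers m σ)) (h0 : R.numAttack = 0)
    (hp : 0 < #R.participants) :
    ghat = (1 / (#R.participants : ℝ)) • ∑ i ∈ R.participants, R.grad i := by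
  have hp' : (#R.participants : ℝ) ≠ 0 := by positivity
  have hnot : ∀ i ∈ R.participants, R.Follows m σ i := by
    intro i hi
    by_contra h
    have : i ∈ R.attackers m σ := mem_attackers.2 ⟨hi, h⟩
    rw [h0, eq_comm, card_eq_zero] at hcount
    rw [hcount] at this
    exact notMem_empty i this
  have hδ : R.delta m = 0 := by simp [delta, h0]
  rw [← sub_eq_zero, ← norm_eq_zero, ← sq_eq_zero_iff,
    ← sum_norm_sq_subvec_splitPart R.participants hp]
  refine sum_eq_zero fun j hj => ?_
  have hcc : R.IsCenteredClip m σ j (subvec (R.part j) R.announced) := (hnot j hj).2.1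
  have hcc' : R.IsCenteredClip m σ j (subvec (R.part j) ghat) := by
    by_cases he : R.AggregatorExposed m σ j
    · exact (hout j hj).1 he
    · rw [(hout j hj).2 he]; exact hcc
  have h1 : ∑ i ∈ R.participants, (subvec (R.part j) (R.grad i) - subvec (R.part j) ghat) = 0 := by
    rw [← hcc']
    refine sum_congr rfl fun i hi => ?_
    rw [clippedDiff, clip, if_pos hδ, one_smul, (hnot i hi).1]
  rw [sum_sub_distrib, sum_const, ← subvec_sum, sub_eq_zero, ← Nat.cast_smul_eq_nsmul ℝ] at h1
  have h2 : subvec (R.part j) ((1 / (#R.participants : ℝ)) • ∑ i ∈ R.participants, R.grad i) =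
      (1 / (#R.participants : ℝ)) • subvec (R.part j) (∑ i ∈ R.participants, R.grad i) := rfl
  change ‖subvec (R.part j) _‖ ^ 2 = 0
  rw [subvec_sub, h2, h1, smul_smul, one_div, inv_mul_cancel₀ hp', one_smul, sub_self, norm_zero]
  norm_num

end Round

/-! ### Expectations over i.i.d. samples -/

/-- `F` is integrable with mean at most `b`. -/
def MeanLE {Ω : Type*} [MeasurableSpace Ω] (μ : Measure Ω) (F : Ω → ℝ) (b : ℝ) : Prop :=
  Integrable F μ ∧ ∫ ω, F ω ∂μ ≤ b

namespace MeanLE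

variable {Ω : Type*} [MeasurableSpace Ω] {μ : Measure Ω} {F G : Ω → ℝ} {a b : ℝ}

lemma add (hF : MeanLE μ F a) (hG : MeanLE μ G b) : MeanLE μ (fun ω => F ω + G ω) (a + b) :=
  ⟨hF.1.add hG.1, by rw [integral_add hF.1 hG.1]; exact add_le_add hF.2 hG.2⟩

lemma const_mul (hF : MeanLE μ F a) {c : ℝ} (hc : 0 ≤ c) : MeanLE μ (fun ω => c * F ω) (c * a) :=
  ⟨hF.1.const_mul c, by rw [integral_const_mul]; exact mul_le_mul_of_nonneg_left hF.2 hc⟩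

lemma div_const (hF : MeanLE μ F a) {c : ℝ} (hc : 0 ≤ c) : MeanLE μ (fun ω => F ω / c) (a / c) :=
  ⟨hF.1.div_const c, by rw [integral_div]; exact div_le_div_of_nonneg_right hF.2 hc⟩

lemma const [IsProbabilityMeasure μ] (c : ℝ) : MeanLE μ (fun _ => c) c :=
  ⟨integrable_const c, by simp⟩

lemma sum {ι : Type*} {s : Finset ι} {F : ι → Ω → ℝ} {a : ι → ℝ}
    (h : ∀ i ∈ s, MeanLE μ (F i) (a i)) : MeanLE μ (fun ω => ∑ i ∈ s, F i ω) (∑ i ∈ s, a i) :=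
  ⟨integrable_finsetSum s fun i hi => (h i hi).1, by
    rw [integral_finsetSum s fun i hi => (h i hi).1]; exact sum_le_sum fun i hi => (h i hi).2⟩

lemma mono (hF : MeanLE μ F a) (h : a ≤ b) : MeanLE μ F b := ⟨hF.1, hF.2.trans h⟩

lemma lintegral_le (hF : MeanLE μ F a) (h0 : ∀ ω, 0 ≤ F ω) :
    ∫⁻ ω, ENNReal.ofReal (F ω) ∂μ ≤ ENNReal.ofReal a := by
  rw [← ofReal_integral_eq_lintegral_ofReal hF.1 (Filter.Eventually.of_forall h0)]
  exact ENNReal.ofReal_le_ofReal hF.2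

end MeanLE

section Samples

variable {Ξ : Type*} [MeasurableSpace Ξ] {D : Measure Ξ} [IsProbabilityMeasure D] {n : ℕ}

lemma MeanLE.comp_eval {F : Ξ → ℝ} {b : ℝ} (h : MeanLE D F b) (i : Fin n) :
    MeanLE (Measure.pi fun _ : Fin n => D) (fun ζ => F (ζ i)) b :=
  ⟨integrable_comp_eval (μ := fun _ : Fin n => D) (i := i) h.1, by
    rw [integral_comp_eval (μ := fun _ : Fin n => D) (i := i) h.1.1]; exact h.2⟩

lemma meanLE_mul_eval {F : Ξ → ℝ} {v : ℝ} (hF : Measurable F) (h0 : ∀ ξ, 0 ≤ F ξ)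
    (h : MeanLE D F v) {i j : Fin n} (hij : i ≠ j) :
    MeanLE (Measure.pi fun _ : Fin n => D) (fun ζ => F (ζ i) * F (ζ j)) (v ^ 2) := by
  have hind : IndepFun (fun ζ : Fin n → Ξ => F (ζ i)) (fun ζ => F (ζ j))
      (Measure.pi fun _ : Fin n => D) :=
    (iIndepFun_pi (μ := fun _ : Fin n => D) (X := fun _ => F) fun _ => hF.aemeasurable).indepFun hij
  have hi := h.comp_eval i
  have hj := h.comp_eval j
  refine ⟨hind.integrable_mul hi.1 hj.1, ?_⟩
  rw [hind.integral_fun_mul_eq_mul_integral hi.1.1 hj.1.1, sq]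
  exact mul_le_mul hi.2 hj.2 (integral_nonneg fun ζ => h0 _)
    ((integral_nonneg fun ζ => h0 (ζ i)).trans hi.2)

lemma integral_sq_sum_eval {y : Ξ → ℝ} (hy : MemLp y 2 D) (h0 : ∫ ξ, y ξ ∂D = 0)
    (Q : Finset (Fin n)) :
    Integrable (fun ζ : Fin n → Ξ => (∑ i ∈ Q, y (ζ i)) ^ 2) (Measure.pi fun _ => D) ∧
    ∫ ζ : Fin n → Ξ, (∑ i ∈ Q, y (ζ i)) ^ 2 ∂(Measure.pi fun _ => D) =
      #Q * ∫ ξ, y ξ ^ 2 ∂D := by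
  set P := Measure.pi fun _ : Fin n => D
  have hL : ∀ i ∈ Q, MemLp (fun ζ : Fin n → Ξ => y (ζ i)) 2 P := fun i _ =>
    hy.comp_measurePreserving (measurePreserving_eval (fun _ : Fin n => D) i)
  have hm : ∀ i, ∫ ζ : Fin n → Ξ, y (ζ i) ∂P = 0 := fun i => by
    rw [integral_comp_eval (μ := fun _ : Fin n => D) (i := i) hy.1, h0]
  have hs := memLp_finsetSum Q hL
  refine ⟨hs.integrable_sq, ?_⟩
  have hmean : ∫ ζ, ∑ i ∈ Q, y (ζ i) ∂P = 0 := by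
    rw [integral_finsetSum Q fun i hi => (hL i hi).integrable (by norm_num)]
    exact sum_eq_zero fun i _ => hm i
  have hvar : Var[∑ i ∈ Q, fun ζ : Fin n → Ξ => y (ζ i); P] =
      ∑ i ∈ Q, Var[fun ζ : Fin n → Ξ => y (ζ i); P] :=
    IndepFun.variance_sum hL fun i _ j _ hij =>
      (iIndepFun_pi (μ := fun _ : Fin n => D) (X := fun _ => y)
        fun _ => hy.1.aemeasurable).indepFun hij
  have e : (∑ i ∈ Q, fun ζ : Fin n → Ξ => y (ζ i)) = fun ζ => ∑ i ∈ Q, y (ζ i) := by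
    ext ζ; simp
  rw [e, variance_of_integral_eq_zero hs.1.aemeasurable hmean] at hvar
  rw [hvar, ← nsmul_eq_mul, ← sum_const]
  refine sum_congr rfl fun i hi => ?_
  rw [variance_of_integral_eq_zero (hL i hi).1.aemeasurable (hm i)]
  exact integral_comp_eval (μ := fun _ : Fin n => D) (i := i) (f := fun ξ => y ξ ^ 2)
    (hy.1.pow 2)

lemma meanLE_norm_sq_sum {κ : Type*} [Fintype κ] {z : Ξ → EuclideanSpace ℝ κ} (hz : Measurable z)
    {v : ℝ} (h : MeanLE D (fun ξ => ‖z ξ‖ ^ 2) v) (h0 : ∀ c, ∫ ξ, z ξ c ∂D = 0)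
    (Q : Finset (Fin n)) :
    MeanLE (Measure.pi fun _ : Fin n => D) (fun ζ => ‖∑ i ∈ Q, z (ζ i)‖ ^ 2) (#Q * v) := by
  have hc : ∀ c, MemLp (fun ξ => z ξ c) 2 D := fun c => by
    have hm : Measurable fun ξ => z ξ c := by fun_prop
    refine (memLp_two_iff_integrable_sq hm.aestronglyMeasurable).2
      (h.1.mono' (hm.pow_const 2).aestronglyMeasurable (Filter.Eventually.of_forall fun ξ => ?_))
    rw [Real.norm_of_nonneg (sq_nonneg _), EuclideanSpace.real_norm_sq_eq]
    exact single_le_sum (f := fun c => z ξ c ^ 2) (fun _ _ => sq_nonneg _) (mem_univ c)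
  have e : (fun ζ : Fin n → Ξ => ‖∑ i ∈ Q, z (ζ i)‖ ^ 2) =
      fun ζ => ∑ c, (∑ i ∈ Q, z (ζ i) c) ^ 2 := by
    ext ζ
    rw [EuclideanSpace.real_norm_sq_eq]
    simp
  rw [e]
  refine (MeanLE.sum fun c _ => ⟨(integral_sq_sum_eval (hc c) (h0 c) Q).1,
    (integral_sq_sum_eval (hc c) (h0 c) Q).2.le⟩).mono ?_
  rw [← mul_sum, ← integral_finsetSum _ fun c _ => (hc c).integrable_sq]
  refine mul_le_mul_of_nonneg_left (le_trans (le_of_eq ?_) h.2) (by positivity)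
  exact integral_congr_ae (Filter.Eventually.of_forall fun ξ =>
    (EuclideanSpace.real_norm_sq_eq _).symm)

lemma measurable_ite_lt {z : Ξ → ℝ} (hz : Measurable z) (s : ℝ) :
    Measurable fun ξ => if s < z ξ then (1 : ℝ) else 0 :=
  Measurable.ite (measurableSet_lt measurable_const hz) measurable_const measurable_const

/-- The indicator does not involve `z i`, so the mean factors. By Markov an input exceeds `s` with
probability at most `1/100`, and by Chebyshev the event that `3/10 #Q` of the others do so has
probability at most `1 / #Q`. -/
lemma meanLE_manyLarge {V : Type*} [NormedAddCommGroup V] [MeasurableSpace V] [BorelSpace V]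
    {z : Ξ → V} (hz : Measurable z) {v s : ℝ} (hs : 0 < s)
    (h : MeanLE D (fun ξ => ‖z ξ‖ ^ 2) v) (hv : v ≤ s ^ 2 / 100) (Q : Finset (Fin n)) (hQ : 0 < #Q)
    (i : Fin n) :
    MeanLE (Measure.pi fun _ : Fin n => D)
      (fun ζ => ‖z (ζ i)‖ ^ 2 * manyLarge Q s (fun l => z (ζ l)) i) (v / #Q) := by
  have hQ' : (0 : ℝ) < #Q := by exact_mod_cast hQ
  set P := Measure.pi fun _ : Fin n => D
  have hv0 : 0 ≤ v := (integral_nonneg fun ξ => by positivity).trans h.2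
  set χ : Ξ → ℝ := fun ξ => if s < ‖z ξ‖ then 1 else 0 with hχ
  have hχm : Measurable χ := measurable_ite_lt hz.norm s
  have hχ01 : ∀ ξ, 0 ≤ χ ξ ∧ χ ξ ≤ 1 := fun ξ => by
    simp only [hχ]; split_ifs <;> norm_num
  have hχL : MemLp χ 2 D := MemLp.of_bound hχm.aestronglyMeasurable 1
    (Filter.Eventually.of_forall fun ξ => by
      rw [Real.norm_of_nonneg (hχ01 ξ).1]; exact (hχ01 ξ).2)
  have hχI := hχL.integrable (by norm_num)
  set q := ∫ ξ, χ ξ ∂D with hq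
  have hq0 : 0 ≤ q := integral_nonneg fun ξ => (hχ01 ξ).1
  have hq1 : q ≤ 1 / 100 := by
    have h1 : q ≤ ∫ ξ, ‖z ξ‖ ^ 2 / s ^ 2 ∂D := by
      refine integral_mono hχI (h.1.div_const _) fun ξ => ?_
      simp only [hχ]
      split_ifs with hlt
      · rw [le_div_iff₀ (by positivity), one_mul]; gcongr
      · positivity
    rw [integral_div] at h1
    refine h1.trans ?_
    rw [div_le_iff₀ (by positivity)]
    linarith [h.2]
  set y : Ξ → ℝ := fun ξ => χ ξ - q
  have hyL : MemLp y 2 D := hχL.sub (memLp_const q)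
  have hy0 : ∫ ξ, y ξ ∂D = 0 := by
    rw [integral_sub hχI (integrable_const q)]; simp [hq]
  have hysq : ∫ ξ, y ξ ^ 2 ∂D ≤ 1 / 100 := by
    have h1 : Var[χ; D] ≤ ∫ ξ, χ ξ ^ 2 ∂D := variance_le_expectation_sq hχm.aestronglyMeasurable
    rw [variance_eq_integral hχm.aemeasurable] at h1
    refine h1.trans (le_trans ?_ hq1)
    refine integral_mono hχL.integrable_sq hχI fun ξ => ?_
    have := hχ01 ξ
    simp only
    nlinarith
  set T := Q.erase i with hT
  have hTc : (#T : ℝ) ≤ #Q := by exact_mod_cast card_le_card (erase_subset i Q)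
  obtain ⟨hSI, hSE⟩ := integral_sq_sum_eval hyL hy0 T
  set M : (Fin n → Ξ) → ℝ := fun ζ => manyLarge Q s (fun l => z (ζ l)) i with hM
  have hMm : Measurable M := by
    refine Measurable.ite (measurableSet_le measurable_const ?_) measurable_const measurable_const
    exact Finset.measurable_fun_sum _ fun l _ => hχm.comp (measurable_pi_apply l)
  -- On the event, the centred count is at least `3/10 #Q - 1/100 #Q ≥ 1/10 #Q`, so its square times
  -- `100 / #Q²` dominates the indicator.
  have hMle : ∀ ζ, M ζ ≤ (∑ l ∈ T, y (ζ l)) ^ 2 * (100 / (#Q : ℝ) ^ 2) := by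
    intro ζ
    simp only [hM, manyLarge]
    split_ifs with hbig
    · rw [mul_div_assoc', le_div_iff₀ (by positivity), one_mul]
      have h1 : ∑ l ∈ T, y (ζ l) = ∑ l ∈ T, χ (ζ l) - #T * q := by
        rw [sum_sub_distrib, sum_const, nsmul_eq_mul]
      have h2 : (#T : ℝ) * q ≤ #Q * (1 / 100) := mul_le_mul hTc hq1 hq0 hQ'.le
      have h3 : 1 / 10 * (#Q : ℝ) ≤ ∑ l ∈ T, y (ζ l) := by
        rw [h1]; linarith
      nlinarith
    · positivity
  have hM0 : ∀ ζ, 0 ≤ M ζ := fun ζ => manyLarge_nonneg _ _ _ _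
  have hMI : Integrable M P := (hSI.mul_const _).mono' hMm.aestronglyMeasurable
    (Filter.Eventually.of_forall fun ζ => by
      rw [Real.norm_of_nonneg (hM0 ζ)]; exact hMle ζ)
  have hME : ∫ ζ, M ζ ∂P ≤ 1 / #Q := by
    refine (integral_mono hMI (hSI.mul_const _) hMle).trans ?_
    rw [integral_mul_const, hSE]
    have h1 : (#T : ℝ) * ∫ ξ, y ξ ^ 2 ∂D ≤ #Q * (1 / 100) :=
      mul_le_mul hTc hysq (integral_nonneg fun ξ => sq_nonneg _) hQ'.le
    calc _ ≤ #Q * (1 / 100) * (100 / (#Q : ℝ) ^ 2) := by gcongr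
      _ = 1 / #Q := by field_simp
  have hind : IndepFun (fun ζ : Fin n → Ξ => ‖z (ζ i)‖ ^ 2) M P := by
    have h1 := (iIndepFun_pi (μ := fun _ : Fin n => D) (X := fun _ => (id : Ξ → Ξ))
      fun _ => aemeasurable_id).indepFun_finset {i} T (by simp [hT]) fun i => measurable_pi_apply i
    have hφ : Measurable fun a : (({i} : Finset (Fin n)) → Ξ) =>
        ‖z (a ⟨i, mem_singleton_self i⟩)‖ ^ 2 :=
      (hz.norm.pow_const 2).comp (measurable_pi_apply _)
    have hψ : Measurable fun a : (T → Ξ) =>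
        if 3 / 10 * (#Q : ℝ) ≤ ∑ l : T, χ (a l) then (1 : ℝ) else 0 :=
      Measurable.ite (measurableSet_le measurable_const
        (Finset.measurable_fun_sum _ fun l _ => hχm.comp (measurable_pi_apply l)))
        measurable_const measurable_const
    have h2 := h1.comp hφ hψ
    have e : M = (fun a : (T → Ξ) =>
        if 3 / 10 * (#Q : ℝ) ≤ ∑ l : T, χ (a l) then (1 : ℝ) else 0) ∘
        fun (ζ : Fin n → Ξ) (l : T) => ζ l := by
      funext ζ
      simp only [hM, manyLarge, Function.comp_apply]
      rw [← hT, ← sum_coe_sort T]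
    rw [e]
    exact h2
  have hzi := h.comp_eval i
  refine ⟨hind.integrable_mul hzi.1 hMI, ?_⟩
  rw [hind.integral_fun_mul_eq_mul_integral hzi.1.1 hMI.1, div_eq_mul_one_div]
  exact mul_le_mul hzi.2 hME (integral_nonneg hM0) hv0

lemma meanLE_tailBound {V : Type*} [NormedAddCommGroup V] [MeasurableSpace V] [BorelSpace V]
    {z : Ξ → V} (hz : Measurable z) {v s : ℝ} (hs : 0 < s)
    (h : MeanLE D (fun ξ => ‖z ξ‖ ^ 2) v) (hv : v ≤ s ^ 2 / 100) (Q : Finset (Fin n))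
    (hQ : 0 < #Q) :
    MeanLE (Measure.pi fun _ : Fin n => D) (fun ζ => tailBound Q s fun i => z (ζ i))
      (4 * v / #Q) := by
  have hQ' : (0 : ℝ) < #Q := by exact_mod_cast hQ
  refine ((MeanLE.sum fun i _ => meanLE_manyLarge hz hs h hv Q hQ i).const_mul
    (c := 4 / (#Q : ℝ)) (by positivity)).mono ?_
  rw [sum_const, nsmul_eq_mul]
  apply le_of_eq
  field_simp

/-- The sum of centred independent inputs has mean square `#Q v`, and the off-diagonal products have
mean at most `v²`. Second moments therefore suffice. -/
lemma meanLE_clipBound {κ : Type*} [Fintype κ] {z : Ξ → EuclideanSpace ℝ κ} (hz : Measurable z)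
    {v : ℝ} (h : MeanLE D (fun ξ => ‖z ξ‖ ^ 2) v) (h0 : ∀ c, ∫ ξ, z ξ c ∂D = 0) (c : ℕ)
    {τ : ℝ} (Q : Finset (Fin n)) (hQ : 0 < #Q) :
    MeanLE (Measure.pi fun _ : Fin n => D) (fun ζ => clipBound Q c τ fun i => z (ζ i))
      (30000 * (((c : ℝ) / #Q) ^ 2 * τ ^ 2 + 2 * v / #Q + v ^ 2 / τ ^ 2)) := by
  have hQ' : (0 : ℝ) < #Q := by exact_mod_cast hQ
  have h1 := (meanLE_norm_sq_sum hz h h0 Q).div_const (c := (#Q : ℝ) ^ 2) (by positivity)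
  have h2 := (MeanLE.sum fun i (_ : i ∈ Q) => h.comp_eval i).div_const (c := (#Q : ℝ) ^ 2)
    (by positivity)
  have h3 := (MeanLE.sum fun q (hq : q ∈ Q.offDiag) =>
    meanLE_mul_eval (hz.norm.pow_const 2) (fun ξ => by positivity) h
      (mem_offDiag.1 hq).2.2).div_const (c := (#Q : ℝ) ^ 2 * τ ^ 2) (by positivity)
  refine (((((MeanLE.const _).add h1).add h2).add h3).const_mul (c := 30000) (by norm_num)).mono ?_
  rw [sum_const, sum_const, nsmul_eq_mul, nsmul_eq_mul]
  have h4 : (#Q.offDiag : ℝ) ≤ (#Q : ℝ) ^ 2 := by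
    rw [offDiag_card, sq]
    exact_mod_cast Nat.sub_le _ _
  have h5 : (#Q.offDiag : ℝ) * v ^ 2 / ((#Q : ℝ) ^ 2 * τ ^ 2) ≤ v ^ 2 / τ ^ 2 := by
    calc _ ≤ (#Q : ℝ) ^ 2 * v ^ 2 / ((#Q : ℝ) ^ 2 * τ ^ 2) := by gcongr
      _ = _ := mul_div_mul_left _ _ (by positivity)
  have h6 : (#Q : ℝ) * v / (#Q : ℝ) ^ 2 = v / #Q := by field_simp
  rw [h6]
  have h7 : 2 * v / (#Q : ℝ) = v / #Q + v / #Q := by ring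
  rw [h7]
  linarith

end Samples

/-! ### Smooth functions -/

section Smooth

variable {d : ℕ} {f : Vec d → ℝ} {L : ℝ}

lemma LSmooth.descent (hf : LSmooth f L) (x v : Vec d) :
    f (x + v) ≤ f x + inner ℝ (gradient f x) v + L / 2 * ‖v‖ ^ 2 := by
  set φ : ℝ → ℝ := fun t => f (x + t • v) - t * inner ℝ (gradient f x) v - L * ‖v‖ ^ 2 / 2 * t ^ 2
  have hφ : ∀ t, HasDerivAt φ (inner ℝ (gradient f (x + t • v)) v - inner ℝ (gradient f x) v -
      L * ‖v‖ ^ 2 * t) t := by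
    intro t
    have h1 : HasDerivAt (fun t : ℝ => x + t • v) v t := by
      simpa using ((hasDerivAt_id t).smul_const v).const_add x
    have h2 := (hf.1 (x + t • v)).hasGradientAt.hasFDerivAt.comp_hasDerivAt t h1
    have h3 := (hasDerivAt_id t).mul_const (inner ℝ (gradient f x) v)
    have h4 := ((hasDerivAt_id t).pow 2).const_mul (L * ‖v‖ ^ 2 / 2)
    refine HasDerivAt.congr_deriv (f := φ) ((h2.sub h3).sub h4) ?_
    simp only [InnerProductSpace.toDual_apply_apply, id]
    push_cast
    ring
  have hanti : AntitoneOn φ (Set.Ici 0) := by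
    refine antitoneOn_of_deriv_nonpos (convex_Ici 0)
      (fun t _ => (hφ t).continuousAt.continuousWithinAt)
      (fun t _ => (hφ t).differentiableAt.differentiableWithinAt) fun t ht => ?_
    rw [interior_Ici, Set.mem_Ioi] at ht
    rw [(hφ t).deriv, ← inner_sub_left]
    have h1 := real_inner_le_norm (gradient f (x + t • v) - gradient f x) v
    have h2 := hf.2 (x + t • v) x
    rw [add_sub_cancel_left, norm_smul, Real.norm_of_nonneg ht.le] at h2
    nlinarith [mul_le_mul_of_nonneg_right h2 (norm_nonneg v)]
  have := hanti (Set.mem_Ici.2 le_rfl) (Set.mem_Ici.2 zero_le_one) zero_le_one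
  simp only [φ, one_smul, zero_smul, add_zero] at this
  linarith

lemma LSmooth.continuous_gradient (hf : LSmooth f L) : Continuous (gradient f) := by
  have : LipschitzWith (Real.toNNReal L) (gradient f) :=
    LipschitzWith.of_dist_le_mul fun x y => by
      rw [dist_eq_norm, dist_eq_norm]
      exact (hf.2 x y).trans (mul_le_mul_of_nonneg_right (Real.le_coe_toNNReal L) (norm_nonneg _))
  exact this.continuous

lemma gradient_eq_zero_of_forall_ge {x : Vec d} (h : ∀ y, f x ≤ f y) : gradient f x = 0 := by
  have : IsLocalMin f x := Filter.Eventually.of_forall h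
  rw [gradient, this.fderiv_eq_zero, map_zero]

/-- Valid for an arbitrary, possibly biased, direction `e`: with `w = e - ∇f x`, both the inner
product `⟨∇f x, w⟩` and the curvature term are absorbed into `‖∇f x‖²` and `‖w‖²`. -/
lemma LSmooth.step_le (hf : LSmooth f L) {γ : ℝ} (hγ : 0 ≤ γ) (hγL : L * γ ≤ 1 / 4)
    (x e : Vec d) :
    f (x - γ • e) + γ / 4 * ‖gradient f x‖ ^ 2 ≤ f x + γ * ‖e - gradient f x‖ ^ 2 := by
  have h := hf.descent x (-(γ • e))
  rw [← sub_eq_add_neg, inner_neg_right, norm_neg, norm_smul, Real.norm_of_nonneg hγ,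
    real_inner_smul_right] at h
  set G := gradient f x
  obtain ⟨w, rfl⟩ : ∃ w, e = G + w := ⟨e - G, by abel⟩
  rw [add_sub_cancel_left]
  have h1 : ‖G + w‖ ^ 2 = ‖G‖ ^ 2 + 2 * inner ℝ G w + ‖w‖ ^ 2 := norm_add_sq_real G w
  have h2 := (abs_le.1 (abs_real_inner_le_norm G w))
  rw [inner_add_right, real_inner_self_eq_norm_sq] at h
  have h3 : L / 2 * (γ * ‖G + w‖) ^ 2 ≤ γ / 8 * ‖G + w‖ ^ 2 := by
    have : L / 2 * (γ * ‖G + w‖) ^ 2 = L * γ * (γ / 2 * ‖G + w‖ ^ 2) := by ring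
    rw [this]
    have : L * γ * (γ / 2 * ‖G + w‖ ^ 2) ≤ 1 / 4 * (γ / 2 * ‖G + w‖ ^ 2) := by gcongr
    linarith
  rw [h1] at h3
  have h4 : 0 ≤ ‖G‖ ^ 2 + ‖w‖ ^ 2 + 2 * inner ℝ G w := by
    nlinarith [sq_nonneg (‖G‖ - ‖w‖)]
  have h5 := mul_nonneg hγ h4
  have h6 := mul_nonneg hγ (sq_nonneg ‖w‖)
  have h7 := mul_nonneg hγ (sq_nonneg ‖G‖)
  nlinarith

end Smooth

/-! ### One iteration at a fixed iterate -/

section FixedIterate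

variable {Ξ : Type*} [MeasurableSpace Ξ] {D : Measure Ξ} {d n : ℕ}
  {f : Vec d → ℝ} {g : Vec d → Ξ → Vec d} {σ : ℝ} {s₀ : ℕ}

lemma measurable_subvec (S : Finset (Fin d)) : Measurable (subvec S) := by
  unfold subvec
  fun_prop

lemma BlockVariance.meanLE_subvec (hv : BlockVariance D g f σ s₀)
    (hg : Measurable (Function.uncurry g)) (x : Vec d) {S : Finset (Fin d)} (hS : s₀ ≤ #S) :
    MeanLE D (fun ξ => ‖subvec S (g x ξ - gradient f x)‖ ^ 2) (#S * σ ^ 2 / d) := by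
  have h := (hv x).2.2 S hS
  have hm : Measurable fun ξ => ‖subvec S (g x ξ - gradient f x)‖ ^ 2 :=
    ((measurable_subvec S).comp
      ((hg.comp measurable_prodMk_left).sub_const _)).norm.pow_const 2
  have e : ∀ ξ, ENNReal.ofReal (‖subvec S (g x ξ - gradient f x)‖ ^ 2) =
      ‖subvec S (g x ξ) - subvec S (gradient f x)‖ₑ ^ 2 := fun ξ => by
    rw [ENNReal.ofReal_pow (norm_nonneg _), ofReal_norm, subvec_sub]
  have hlt : ∫⁻ ξ, ENNReal.ofReal (‖subvec S (g x ξ - gradient f x)‖ ^ 2) ∂D ≤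
      ENNReal.ofReal (#S * σ ^ 2 / d) := by
    rw [lintegral_congr e]; exact h
  refine ⟨⟨hm.aestronglyMeasurable, ?_⟩, ?_⟩
  · rw [hasFiniteIntegral_iff_ofReal (Filter.Eventually.of_forall fun _ => by positivity)]
    exact hlt.trans_lt ENNReal.ofReal_lt_top
  · rw [integral_eq_lintegral_of_nonneg_ae (Filter.Eventually.of_forall fun _ => by positivity)
      hm.aestronglyMeasurable]
    exact ENNReal.toReal_le_of_le_ofReal (by positivity) hlt

lemma BlockVariance.meanLE_norm_sq (hv : BlockVariance D g f σ s₀)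
    (hg : Measurable (Function.uncurry g)) (x : Vec d) (hd : s₀ ≤ d) (hd0 : 0 < d) :
    MeanLE D (fun ξ => ‖g x ξ - gradient f x‖ ^ 2) (σ ^ 2) := by
  have h := hv.meanLE_subvec hg x (S := univ) (by simpa using hd)
  simp only [norm_sq_subvec, ← EuclideanSpace.real_norm_sq_eq] at h
  refine h.mono (le_of_eq ?_)
  have : (d : ℝ) ≠ 0 := by positivity
  rw [card_univ, Fintype.card_fin]
  field_simp

variable [IsProbabilityMeasure D]

lemma BlockVariance.integral_coord (hv : BlockVariance D g f σ s₀) (x : Vec d) (c : Fin d) :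
    ∫ ξ, (g x ξ - gradient f x) c ∂D = 0 := by
  have hi : Integrable (fun ξ => g x ξ - gradient f x) D := (hv x).1.sub (integrable_const _)
  have h := ContinuousLinearMap.integral_comp_comm (EuclideanSpace.proj (𝕜 := ℝ) c) hi
  rw [integral_sub (hv x).1 (integrable_const _), (hv x).2.1] at h
  simpa using h

/-- The bound of `Round.error_le`, with `N` in the role of the number of aggregating peers. -/
noncomputable def attackBound (Q : Finset (Fin n)) (c : ℕ) (N σ : ℝ) (z : Fin n → Vec d) : ℝ :=
  ∑ j ∈ Q, (clipBound Q c
      (clipRadius (c / N) (2 * #(splitPart d #Q #(Q.filter (· < j))) * σ ^ 2 / d))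
      (fun i => subvec (splitPart d #Q #(Q.filter (· < j))) (z i)) +
    tailBound Q (4 * ((1 + √3) * √2 * σ / √N))
      (fun i => subvec (splitPart d #Q #(Q.filter (· < j))) (z i))) +
  c * (25 * ((1 + √3) * √2 * σ / √N) ^ 2)

lemma attackBound_nonneg (Q : Finset (Fin n)) (c : ℕ) (N σ : ℝ) (z : Fin n → Vec d) :
    0 ≤ attackBound Q c N σ z :=
  add_nonneg (sum_nonneg fun _ _ => add_nonneg (clipBound_nonneg _ _ _ _) (tailBound_nonneg _ _ _))
    (by positivity)

lemma deltaMax_sq_bounds {N σ : ℝ} (hN : 0 < N) :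
    14 * (σ ^ 2 / N) ≤ ((1 + √3) * √2 * σ / √N) ^ 2 ∧
      ((1 + √3) * √2 * σ / √N) ^ 2 ≤ 16 * (σ ^ 2 / N) := by
  have h2 : √(2 : ℝ) ^ 2 = 2 := Real.sq_sqrt (by norm_num)
  have h3 : (1.7 : ℝ) ≤ √3 := Real.le_sqrt_of_sq_le (by norm_num)
  have h3' : √(3 : ℝ) ≤ 1.8 := by rw [Real.sqrt_le_left (by norm_num)]; norm_num
  have e : ((1 + √3) * √2 * σ / √N) ^ 2 = (1 + √3) ^ 2 * 2 * (σ ^ 2 / N) := by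
    rw [div_pow, mul_pow, mul_pow, h2, Real.sq_sqrt hN.le]; ring
  rw [e]
  constructor
  · gcongr; nlinarith
  · gcongr; nlinarith

/-- With `τ² ~ v / δ` and `δ = c / N`, the terms `(c / #Q)² τ²` and `v² / τ²` are both of order `v c
/ #Q`, and the terms `v / #Q` are no larger because `c ≥ 1`. The part variances `v = d_j σ² / d` sum
to `σ²`. The surviving wrong parts add `25 c Δ_max²`, again of order `σ² c / #Q`. -/
lemma BlockVariance.meanLE_attackBound (hv : BlockVariance D g f σ s₀)
    (hg : Measurable (Function.uncurry g)) (hσ : 0 < σ) (hs : 1 ≤ s₀) (hd : n * s₀ ≤ d)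
    (Q : Finset (Fin n)) (hQ : 0 < #Q) {c : ℕ} (hc : 1 ≤ c) {N : ℝ} (hN : 0 < N) (hNQ : N ≤ #Q)
    (hQN : #Q ≤ 2 * N) (hcN : c / N ≤ 0.1) (x : Vec d) :
    MeanLE (Measure.pi fun _ : Fin n => D)
      (fun ζ => attackBound Q c N σ fun i => g x (ζ i) - gradient f x)
      (8000000 * σ ^ 2 * c / #Q) := by
  have hQ' : (0 : ℝ) < #Q := by exact_mod_cast hQ
  have hc' : (1 : ℝ) ≤ c := by exact_mod_cast hc
  have hQn : #Q ≤ n := by simpa using card_le_univ Q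
  have hQd : #Q ≤ d := hQn.trans ((Nat.le_mul_of_pos_right n hs).trans hd)
  have hd0 : (0 : ℝ) < d := by exact_mod_cast hQ.trans_le hQd
  have hδ : 0 < c / N := by positivity
  obtain ⟨hΔ1, hΔ2⟩ := deltaMax_sq_bounds (σ := σ) hN
  have hΔ0 : 0 < (1 + √3) * √2 * σ / √N := by positivity
  set Δ := (1 + √3) * √2 * σ / √N with hΔ
  have hpart : ∀ j ∈ Q, MeanLE (Measure.pi fun _ : Fin n => D) (fun ζ =>
      clipBound Q c
        (clipRadius (c / N) (2 * #(splitPart d #Q #(Q.filter (· < j))) * σ ^ 2 / d))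
        (fun i => subvec (splitPart d #Q #(Q.filter (· < j))) (g x (ζ i) - gradient f x)) +
      tailBound Q (4 * Δ)
        (fun i => subvec (splitPart d #Q #(Q.filter (· < j))) (g x (ζ i) - gradient f x)))
      (#(splitPart d #Q #(Q.filter (· < j))) * (7300000 * (σ ^ 2 / d * (c / #Q)))) := by
    intro j hj
    have hidx := card_filter_lt_lt_card hj
    set S := splitPart d #Q #(Q.filter (· < j))
    have hS1 : d / #Q ≤ #S := div_le_card_splitPart hidx
    have hS2 : #S ≤ d / #Q + 1 := card_splitPart_le hidx
    have hSs : s₀ ≤ #S := by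
      refine le_trans ?_ hS1
      rw [Nat.le_div_iff_mul_le hQ, mul_comm]
      exact (Nat.mul_le_mul_right _ hQn).trans hd
    have hS0 : (0 : ℝ) < #S := by exact_mod_cast hs.trans hSs
    have hSu : (#S : ℝ) * #Q ≤ 2 * d := by
      have h1 : #S * #Q ≤ (d / #Q + 1) * #Q := Nat.mul_le_mul_right _ hS2
      have h2 : d / #Q * #Q ≤ d := Nat.div_mul_le_self d #Q
      have : #S * #Q ≤ 2 * d := by rw [add_one_mul] at h1; omega
      exact_mod_cast this
    have hmean := hv.meanLE_subvec hg x hSs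
    set v := #S * σ ^ 2 / d with hvdef
    have hv0 : 0 < v := by positivity
    have hV : 2 * #S * σ ^ 2 / d = 2 * v := by rw [hvdef]; ring
    -- The threshold is just large enough for `meanLE_manyLarge`: `v ≤ 2 σ² / #Q` by near-equality
    -- of the part sizes, while `16 * 14 / 100 > 2`.
    have hvΔ : v ≤ (4 * Δ) ^ 2 / 100 := by
      have h1 : v ≤ 2 * (σ ^ 2 / #Q) := by
        rw [hvdef, mul_div_assoc', div_le_div_iff₀ hd0 hQ']
        nlinarith [mul_le_mul_of_nonneg_right hSu (sq_nonneg σ)]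
      have h2 : σ ^ 2 / #Q ≤ σ ^ 2 / N := by gcongr
      have h3 : 0 ≤ σ ^ 2 / N := by positivity
      rw [mul_pow]
      linarith
    have hzm : Measurable fun ξ => subvec S (g x ξ - gradient f x) :=
      (measurable_subvec S).comp ((hg.comp measurable_prodMk_left).sub_const _)
    rw [hV]
    obtain ⟨hτ0, hτ1, hτ2⟩ := clipRadius_sq hδ hcN (v := 2 * v) (by positivity)
    set τ := clipRadius (c / N) (2 * v)
    refine ((meanLE_clipBound hzm hmean (fun e => hv.integral_coord x e) c (τ := τ) Q hQ).add
      (meanLE_tailBound hzm (by positivity) hmean hvΔ Q hQ)).mono ?_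
    have hr : #S * (7300000 * (σ ^ 2 / d * (c / #Q))) = 7300000 * (v * c / #Q) := by
      rw [hvdef]; ring
    rw [hr]
    have h1 : ((c : ℝ) / #Q) ^ 2 * τ ^ 2 ≤ 240 * (v * c / #Q) := by
      calc ((c : ℝ) / #Q) ^ 2 * τ ^ 2 ≤ ((c : ℝ) / #Q) ^ 2 * (120 * (2 * v / (c / N))) := by gcongr
        _ = 240 * (v * c / #Q) * (N / #Q) := by field_simp; norm_num
        _ ≤ 240 * (v * c / #Q) * 1 := by
          gcongr
          exact (div_le_one hQ').2 hNQ
        _ = _ := mul_one _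
    have h2 : v ^ 2 / τ ^ 2 ≤ v * c / #Q := by
      calc v ^ 2 / τ ^ 2 ≤ v ^ 2 / (2 * v / (c / N)) := by gcongr
        _ = v * c / (2 * N) := by field_simp
        _ ≤ v * c / #Q := by gcongr
    have h3 : v / #Q ≤ v * c / #Q := by
      gcongr
      nlinarith
    have h4 : 2 * v / #Q = 2 * (v / #Q) := by ring
    have h5 : 4 * v / #Q = 4 * (v / #Q) := by ring
    have h6 : 0 ≤ v * c / #Q := by positivity
    rw [h4, h5]
    -- The constants add up to `30000 * (240 + 2 + 1) + 4 ≤ 7300000`.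
    linarith
  refine ((MeanLE.sum hpart).add (MeanLE.const _)).mono ?_
  rw [← sum_mul, sum_card_splitPart Q hQ]
  have h1 : (d : ℝ) * (7300000 * (σ ^ 2 / d * (c / #Q))) = 7300000 * (σ ^ 2 * c / #Q) := by
    field_simp
  have h2 : c * (25 * Δ ^ 2) ≤ 800 * (σ ^ 2 * c / #Q) := by
    calc c * (25 * Δ ^ 2) ≤ c * (25 * (16 * (σ ^ 2 / N))) := by gcongr
      _ = 800 * (σ ^ 2 * c / (2 * N)) := by field_simp; norm_num
      _ ≤ _ := by gcongr
  have h3 : 0 ≤ σ ^ 2 * c / #Q := by positivity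
  have h4 : 8000000 * σ ^ 2 * c / #Q = 8000000 * (σ ^ 2 * c / #Q) := by ring
  rw [h1, h4]
  linarith

/-- Unbiasedness removes the term linear in the noise, so the noise enters only through the
curvature term, with a factor `γ²` and variance `σ² / #Q`. This is what separates attack-free
iterations from attacked ones. -/
lemma BlockVariance.mean_step (hv : BlockVariance D g f σ s₀)
    (hg : Measurable (Function.uncurry g)) (hd : s₀ ≤ d) (hd0 : 0 < d) {L : ℝ}
    (hL : 0 ≤ L) (hf : LSmooth f L) {γ fstar : ℝ} (hγ : 0 ≤ γ) (hγL : L * γ ≤ 1 / 4)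
    (hstar : ∀ x, fstar ≤ f x) (Q : Finset (Fin n)) (hQ : 0 < #Q) (x : Vec d) :
    ∫⁻ ζ : Fin n → Ξ, (ENNReal.ofReal (f (x - γ • ((1 / (#Q : ℝ)) • ∑ i ∈ Q, g x (ζ i))) - fstar) +
        ENNReal.ofReal (γ / 4 * ‖gradient f x‖ ^ 2)) ∂(Measure.pi fun _ => D) ≤
      ENNReal.ofReal (f x - fstar + L * γ ^ 2 * σ ^ 2 / #Q) := by
  have hQ' : (0 : ℝ) < #Q := by exact_mod_cast hQ
  set G := gradient f x with hG
  set z : Ξ → Vec d := fun ξ => g x ξ - G with hz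
  have hzm : Measurable z := (hg.comp measurable_prodMk_left).sub_const _
  set B : ℝ := -γ + L * γ ^ 2
  have hz0 : Integrable z D := (hv x).1.sub (integrable_const _)
  have hinner : MeanLE D (fun ξ => B / #Q * inner ℝ G (z ξ)) 0 := by
    refine ⟨(hz0.const_inner G).const_mul _, ?_⟩
    rw [integral_const_mul, integral_inner hz0]
    simp only [hz]
    rw [integral_sub (hv x).1 (integrable_const _), (hv x).2.1]
    simp [hG]
  have hM := (((MeanLE.const (μ := Measure.pi fun _ : Fin n => D)
    (f x - fstar - γ * ‖G‖ ^ 2 + L * γ ^ 2 / 2 * ‖G‖ ^ 2 + γ / 4 * ‖G‖ ^ 2)).add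
    (MeanLE.sum fun i (_ : i ∈ Q) => hinner.comp_eval i)).add
    (((meanLE_norm_sq_sum hzm (hv.meanLE_norm_sq hg x hd hd0) (hv.integral_coord x) Q).div_const
      (c := (#Q : ℝ) ^ 2) (by positivity)).const_mul (c := L * γ ^ 2 / 2) (by positivity)))
  have hpt : ∀ ζ : Fin n → Ξ,
      f (x - γ • ((1 / (#Q : ℝ)) • ∑ i ∈ Q, g x (ζ i))) - fstar + γ / 4 * ‖G‖ ^ 2 ≤
      f x - fstar - γ * ‖G‖ ^ 2 + L * γ ^ 2 / 2 * ‖G‖ ^ 2 + γ / 4 * ‖G‖ ^ 2 +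
      ∑ i ∈ Q, B / #Q * inner ℝ G (z (ζ i)) +
      L * γ ^ 2 / 2 * (‖∑ i ∈ Q, z (ζ i)‖ ^ 2 / #Q ^ 2) := by
    intro ζ
    set w := (1 / (#Q : ℝ)) • ∑ i ∈ Q, z (ζ i) with hw
    have hmean : (1 / (#Q : ℝ)) • ∑ i ∈ Q, g x (ζ i) = G + w := by
      rw [hw]
      simp only [hz]
      rw [sum_sub_distrib, sum_const, ← Nat.cast_smul_eq_nsmul ℝ, smul_sub, smul_smul, one_div,
        inv_mul_cancel₀ hQ'.ne', one_smul]
      abel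
    have hw2 : ‖w‖ ^ 2 = ‖∑ i ∈ Q, z (ζ i)‖ ^ 2 / #Q ^ 2 := by
      rw [hw, norm_smul, Real.norm_of_nonneg (by positivity), mul_pow]
      ring
    have hwi : ∑ i ∈ Q, B / #Q * inner ℝ G (z (ζ i)) = B * inner ℝ G w := by
      rw [hw, real_inner_smul_right, inner_sum, ← mul_sum]
      ring
    have h := hf.descent x (-(γ • (G + w)))
    rw [← sub_eq_add_neg, inner_neg_right, norm_neg, norm_smul, Real.norm_of_nonneg hγ,
      real_inner_smul_right, ← hG, inner_add_right, real_inner_self_eq_norm_sq, mul_pow,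
      norm_add_sq_real] at h
    rw [hmean, hwi, ← hw2]
    simp only [B]
    linarith
  have hpos : ∀ ζ : Fin n → Ξ,
      0 ≤ f (x - γ • ((1 / (#Q : ℝ)) • ∑ i ∈ Q, g x (ζ i))) - fstar + γ / 4 * ‖G‖ ^ 2 := fun ζ =>
    add_nonneg (sub_nonneg.2 (hstar _)) (by positivity)
  refine (lintegral_mono fun ζ => ?_).trans ((hM.lintegral_le fun ζ =>
    (hpos ζ).trans (hpt ζ)).trans (ENNReal.ofReal_le_ofReal ?_))
  · rw [← ENNReal.ofReal_add (sub_nonneg.2 (hstar _)) (by positivity)]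
    exact ENNReal.ofReal_le_ofReal (hpt ζ)
  · rw [sum_const_zero]
    have h1 : L * γ ^ 2 / 2 * (#Q * σ ^ 2 / (#Q : ℝ) ^ 2) = L * γ ^ 2 * σ ^ 2 / #Q / 2 := by
      field_simp
    have h2 : 0 ≤ L * γ ^ 2 * σ ^ 2 / #Q := by positivity
    have h3 : L * γ ^ 2 * ‖G‖ ^ 2 ≤ 1 / 4 * (γ * ‖G‖ ^ 2) := by
      have : L * γ ^ 2 * ‖G‖ ^ 2 = L * γ * (γ * ‖G‖ ^ 2) := by ring
      rw [this]
      gcongr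
    have h4 : 0 ≤ γ * ‖G‖ ^ 2 := by positivity
    rw [h1]
    linarith

lemma measurable_attackBound {α : Type*} [MeasurableSpace α] (Q : Finset (Fin n)) (c : ℕ)
    (N σ : ℝ) {z : α → Fin n → Vec d} (hz : ∀ i, Measurable fun a => z a i) :
    Measurable fun a => attackBound Q c N σ (z a) := by
  have hs : ∀ (S : Finset (Fin d)) i, Measurable fun a => subvec S (z a i) := fun S i =>
    (measurable_subvec S).comp (hz i)
  have hn : ∀ (S : Finset (Fin d)) i, Measurable fun a => ‖subvec S (z a i)‖ := fun S i =>
    (hs S i).norm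
  refine Measurable.add (Finset.measurable_fun_sum _ fun j _ => Measurable.add ?_ ?_)
    measurable_const
  · unfold clipBound
    have h1 : ∀ S : Finset (Fin d), Measurable fun a => ∑ i ∈ Q, subvec S (z a i) := fun S =>
      Finset.measurable_fun_sum _ fun i _ => hs S i
    have h2 := fun S : Finset (Fin d) => (h1 S).norm
    fun_prop
  · unfold tailBound manyLarge
    refine (Finset.measurable_fun_sum _ fun i _ => ((hn _ i).pow_const 2).mul ?_).const_mul _
    refine Measurable.ite (measurableSet_le measurable_const ?_) measurable_const measurable_const
    exact Finset.measurable_fun_sum _ fun l _ => measurable_ite_lt (hn _ l) _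

end FixedIterate

/-! ### Counting draws -/

section Draws

variable {n m : ℕ}

/-- The draws from the peers in `S`. -/
noncomputable def drawsIn (m : ℕ) (S : Finset (Fin n)) : Finset (Draw n m) :=
  univ.filter fun e => ∀ t, e t ∈ S

lemma card_drawsIn (S : Finset (Fin n)) : #(drawsIn m S) = (#S).descFactorial (2 * m) := by
  have h : Fintype.card ((Fin m ⊕ Fin m) ↪ S) = (#S).descFactorial (2 * m) := by
    rw [Fintype.card_embedding_eq, Fintype.card_sum, Fintype.card_fin, Fintype.card_coe, two_mul]
  rw [← h, ← card_univ]
  symm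
  refine card_bij (fun e _ => e.trans (Function.Embedding.subtype _)) (fun e _ => ?_)
    (fun e₁ _ e₂ _ h => ?_) fun e he => ?_
  · simp [drawsIn]
  · ext t
    have := DFunLike.congr_fun h t
    simpa using congrArg Fin.val this
  · simp only [drawsIn, mem_filter, mem_univ, true_and] at he
    exact ⟨e.codRestrict (S : Set (Fin n)) he, mem_univ _, rfl⟩

lemma swap_mem_of_mem {S : Finset (Fin n)} {i j x : Fin n} (hi : i ∈ S) (hj : j ∈ S) (hx : x ∈ S) :
    Equiv.swap i j x ∈ S := by
  rw [Equiv.swap_apply_def]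
  split_ifs <;> assumption

/-- Relabelling peers by a transposition inside `S` is an injection on the draws from `S`. All exact
counts below come from this symmetry. -/
lemma card_filter_swap_le {S : Finset (Fin n)} {i j : Fin n} (hi : i ∈ S) (hj : j ∈ S)
    (p q : Draw n m → Prop) [DecidablePred p] [DecidablePred q]
    (h : ∀ e, p e → q (e.trans (Equiv.swap i j).toEmbedding)) :
    #((drawsIn m S).filter p) ≤ #((drawsIn m S).filter q) := by
  refine card_le_card_of_injOn (fun e => e.trans (Equiv.swap i j).toEmbedding) (fun e he => ?_)
    fun e₁ _ e₂ _ h => ?_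
  · simp only [drawsIn, coe_filter, mem_filter, mem_univ, true_and, Set.mem_ofPred_eq] at he ⊢
    exact ⟨fun t => swap_mem_of_mem hi hj (he.1 t), h e he.2⟩
  · ext t
    have := DFunLike.congr_fun h t
    exact congrArg Fin.val ((Equiv.swap i j).injective this)

lemma card_mul_card_draws_eq {S : Finset (Fin n)} {i : Fin n} (hi : i ∈ S) (a : Fin m ⊕ Fin m) :
    #S * #((drawsIn m S).filter fun e => e a = i) = #(drawsIn m S) := by
  have h1 : #(drawsIn m S) = ∑ j ∈ S, #((drawsIn m S).filter fun e => e a = j) :=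
    card_eq_sum_card_fiberwise fun e he => (mem_filter.1 he).2 a
  rw [h1, ← smul_eq_mul, ← sum_const]
  refine sum_congr rfl fun j hj => le_antisymm ?_ ?_
  · exact card_filter_swap_le hi hj _ _ fun e he => by simp [he]
  · exact card_filter_swap_le hi hj _ _ fun e he => by simp [he]

lemma card_mul_card_draws_pair_eq {S : Finset (Fin n)} {i j : Fin n} (hi : i ∈ S) (hj : j ∈ S)
    (hij : j ≠ i) {a c : Fin m ⊕ Fin m} (hac : c ≠ a) :
    (#S - 1) * #((drawsIn m S).filter fun e => e a = i ∧ e c = j) =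
      #((drawsIn m S).filter fun e => e a = i) := by
  have h1 : #((drawsIn m S).filter fun e => e a = i) =
      ∑ l ∈ S.erase i, #(((drawsIn m S).filter fun e => e a = i).filter fun e => e c = l) :=
    card_eq_sum_card_fiberwise fun e he => by
      simp only [drawsIn, coe_filter, mem_filter, mem_univ, true_and, Set.mem_ofPred_eq] at he
      exact mem_coe.2 (mem_erase.2 ⟨fun h => hac (e.injective (h.trans he.2.symm)), he.1 c⟩)
  rw [h1, ← card_erase_of_mem hi, ← smul_eq_mul, ← sum_const]
  refine sum_congr rfl fun l hl => ?_
  rw [filter_filter]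
  obtain ⟨hli, hl⟩ := mem_erase.1 hl
  refine le_antisymm ?_ ?_
  · exact card_filter_swap_le hj hl _ _ fun e he => by
      simp [he.1, he.2, Equiv.swap_apply_of_ne_of_ne hij.symm hli.symm]
  · exact card_filter_swap_le hj hl _ _ fun e he => by
      simp [he.1, he.2, Equiv.swap_apply_of_ne_of_ne hij.symm hli.symm]

/-- The draws in which `i` is checked by a validator outside `byz`. -/
noncomputable def catchingDraws (m : ℕ) (byz S : Finset (Fin n)) (i : Fin n) :
    Finset (Draw n m) :=
  (drawsIn m S).filter fun e => ∃ t, e (Sum.inr t) = i ∧ e (Sum.inl t) ∉ byz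

/-- The catching draws split according to the slot `t` that checks `i` and the good validator in it.
At most one slot checks `i`, and a good validator differs from the Byzantine `i`, so each pair
accounts for a fraction `1 / (#S (#S - 1))` of the draws. -/
lemma card_catchingDraws {byz S : Finset (Fin n)} {i : Fin n} (hi : i ∈ S) (hb : i ∈ byz) :
    #S * (#S - 1) * #(catchingDraws m byz S i) = m * #(S \ byz) * #(drawsIn m S) := by
  have h1 : #(catchingDraws m byz S i) = ∑ q ∈ (univ : Finset (Fin m)) ×ˢ (S \ byz),
      #((drawsIn m S).filter fun e => e (Sum.inr q.1) = i ∧ e (Sum.inl q.1) = q.2) := by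
    rw [← card_biUnion]
    · congr 1
      ext e
      simp only [catchingDraws, drawsIn, mem_filter, mem_univ, true_and, mem_biUnion, mem_product,
        mem_sdiff, Prod.exists]
      constructor
      · rintro ⟨he, t, h1, h2⟩
        exact ⟨t, _, ⟨he _, h2⟩, he, h1, rfl⟩
      · rintro ⟨t, _, ⟨-, h2⟩, he, h1, rfl⟩
        exact ⟨he, t, h1, h2⟩
    · rintro ⟨t, j⟩ - ⟨t', j'⟩ - hne
      rw [Function.onFun, disjoint_left]
      intro e he he'
      simp only [mem_filter] at he he'
      have htt : t = t' := Sum.inr_injective (e.injective (he.2.1.trans he'.2.1.symm))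
      subst htt
      exact hne (by rw [← he.2.2, ← he'.2.2])
  rw [h1, mul_sum]
  have h2 : ∀ q ∈ (univ : Finset (Fin m)) ×ˢ (S \ byz), #S * (#S - 1) *
      #((drawsIn m S).filter fun e => e (Sum.inr q.1) = i ∧ e (Sum.inl q.1) = q.2) =
      #(drawsIn m S) := by
    rintro ⟨t, j⟩ hq
    simp only [mem_product, mem_sdiff] at hq
    rw [mul_assoc, card_mul_card_draws_pair_eq hi hq.2.1 (fun h => hq.2.2 (h ▸ hb)) (by simp),
      card_mul_card_draws_eq hi]
  rw [sum_congr rfl h2, sum_const, card_product, card_univ, Fintype.card_fin, smul_eq_mul]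

end Draws

/-! ### Bans and the number of attacks -/

namespace BTARDSGD

variable {Ω : Type*} [mΩ : MeasurableSpace Ω] {μ : Measure Ω} {Ξ : Type*} [MeasurableSpace Ξ]
  {D : Measure Ξ} {d n m : ℕ} {g : Vec d → Ξ → Vec d} {byz : Finset (Fin n)} {σ γ : ℝ} {x₀ : Vec d}
  {K : ℕ} (R : BTARDSGD μ D g byz m σ γ x₀ K)

lemma mid_le {k : ℕ} (hk : k < K) : R.mid k ≤ mΩ := (R.mid_le_past k hk).trans (R.past.le _)

lemma mem_byz_of_not_follows {k : ℕ} (hk : k < K) {ω : Ω} {i : Fin n}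
    (hi : i ∈ (R.round k ω).participants) (h : ¬ (R.round k ω).Follows m σ i) : i ∈ byz := by
  by_contra hb
  exact h (R.good_follow k hk ω i hi hb)

lemma attackers_subset {k : ℕ} (hk : k < K) (ω : Ω) :
    (R.round k ω).attackers m σ ⊆ (R.round k ω).active ∩ byz := fun i hi => by
  rw [Round.mem_attackers] at hi
  exact mem_inter.2 ⟨(mem_sdiff.1 hi.1).1, R.mem_byz_of_not_follows hk hi.1 hi.2⟩

lemma exposed_subset {k : ℕ} (hk : k < K) (ω : Ω) :
    (R.round k ω).exposed m σ byz ⊆ byz := fun i hi => by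
  simp only [Round.exposed, mem_filter] at hi
  refine R.mem_byz_of_not_follows hk hi.1 fun hf => ?_
  rcases hi.2 with h | ⟨j, hj, -, h⟩
  · exact h.2 hf.2.1
  · exact h (hf.2.2 j hj)

lemma caught_subset {k : ℕ} (ω : Ω) :
    caught byz σ (R.round k ω) (R.draw k ω) ⊆ (R.round k ω).attackers m σ := fun i hi => by
  simp only [caught, mem_image, mem_filter] at hi
  obtain ⟨t, ht, rfl⟩ := hi
  exact ht.2.2

lemma caughtBefore_subset {k : ℕ} (hk : k < K) (ω : Ω) :
    caughtBefore byz σ (fun j => R.round j ω) (fun j => R.draw j ω) k ⊆ byz := by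
  cases k with
  | zero => exact empty_subset _
  | succ k =>
    exact (R.caught_subset ω).trans ((R.attackers_subset (k.lt_succ_self.trans hk) ω).trans
      inter_subset_right)

lemma active_succ_subset {k : ℕ} (hk : k < K) (ω : Ω) :
    (R.round (k + 1) ω).active ⊆ (R.round k ω).active := by
  rw [R.active_succ k hk ω]; exact sdiff_subset

/-- Every removal of a good peer costs the adversary a Byzantine peer. -/
lemma card_active_inter_add_le (ω : Ω) {k : ℕ} (hk : k ≤ K) :
    n + #((R.round k ω).active ∩ byz) ≤ #((R.round k ω).active \ byz) + 2 * #byz := by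
  induction k with
  | zero =>
    rw [R.active_zero, univ_inter]
    have h := card_sdiff_add_card_inter (univ : Finset (Fin n)) byz
    rw [univ_inter, card_univ, Fintype.card_fin] at h
    omega
  | succ k ih =>
    have ih := ih (by omega)
    set A := (R.round k ω).active with hA
    set E := R.elim k ω with hE
    have hact := R.active_succ k hk ω
    have hEA : E ⊆ A := R.elim_sub k hk ω
    have hEc : #(E \ byz) ≤ #(E ∩ byz) := R.elim_card k hk ω
    have hex := R.exposed_subset hk ω
    have hca := R.caughtBefore_subset hk ω
    have h1 : A \ byz ⊆ ((R.round (k + 1) ω).active \ byz) ∪ (E \ byz) := by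
      intro i hi
      rw [mem_sdiff] at hi
      rw [hact, mem_union, mem_sdiff, mem_sdiff, mem_sdiff, mem_union, mem_union]
      have := fun h => hi.2 (hex h)
      have := fun h => hi.2 (hca h)
      tauto
    have h2 : ((R.round (k + 1) ω).active ∩ byz) ∪ (E ∩ byz) ⊆ A ∩ byz := by
      intro i hi
      rw [hact] at hi
      simp only [mem_union, mem_inter, mem_sdiff] at hi ⊢
      rcases hi with hi | hi
      · exact ⟨hi.1.1, hi.2⟩
      · exact ⟨hEA hi.1, hi.2⟩
    have h3 : Disjoint ((R.round (k + 1) ω).active ∩ byz) (E ∩ byz) := by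
      rw [disjoint_left]
      intro i hi hi'
      rw [hact] at hi
      simp only [mem_union, mem_inter, mem_sdiff] at hi hi'
      tauto
    have h4 := (card_le_card h1).trans (card_union_le _ _)
    have h5 := card_le_card h2
    rw [card_union_of_disjoint h3] at h5
    omega

/-- By `card_active_inter_add_le` at least `n - 2b` good peers always remain. The first two bounds
follow, and the ratio of Byzantine peers stays below a tenth because good peers are lost at most as
fast as Byzantine ones. -/
lemma card_active_bounds (hm2 : (m : ℝ) ≤ ((n : ℝ) - 2 * #byz) / 2)
    (hb : (#byz : ℝ) ≤ 0.1 * ((n : ℝ) - m)) (ω : Ω) {k : ℕ} (hk : k ≤ K) :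
    2 * m ≤ #(R.round k ω).active ∧ 0.4 * (n : ℝ) ≤ #(R.round k ω).active - m ∧
    (#((R.round k ω).active ∩ byz) : ℝ) ≤ 0.1 * (#(R.round k ω).active - m) := by
  have h1 := R.card_active_inter_add_le ω hk
  have h2 := card_sdiff_add_card_inter (R.round k ω).active byz
  have h3 : #((R.round k ω).active ∩ byz) ≤ #byz := card_le_card inter_subset_right
  have h1' : (n : ℝ) + #((R.round k ω).active ∩ byz) ≤
    #((R.round k ω).active \ byz) + 2 * #byz := by exact_mod_cast h1
  have h2' : (#((R.round k ω).active \ byz) : ℝ) + #((R.round k ω).active ∩ byz) =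
    #(R.round k ω).active := by exact_mod_cast h2
  have h3' : (#((R.round k ω).active ∩ byz) : ℝ) ≤ #byz := by exact_mod_cast h3
  have h4 : (0 : ℝ) ≤ #((R.round k ω).active ∩ byz) := by positivity
  refine ⟨?_, by linarith, by linarith⟩
  have : (2 * m : ℝ) ≤ #(R.round k ω).active := by linarith
  exact_mod_cast this

lemma measurableSet_active {k : ℕ} (hk : k ≤ K) (S : Finset (Fin n)) :
    MeasurableSet[R.past k] {ω | (R.round k ω).active = S} := by
  cases k with
  | zero =>
    simp only [R.active_zero]
    exact MeasurableSet.const _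
  | succ k => exact R.mid_le_past k hk _ (R.active_meas k hk S)

lemma measurableSet_mem_active {k : ℕ} (hk : k ≤ K) (i : Fin n) :
    MeasurableSet {ω | i ∈ (R.round k ω).active} := by
  have : {ω | i ∈ (R.round k ω).active} =
      ⋃ S ∈ univ.filter (fun S : Finset (Fin n) => i ∈ S), {ω | (R.round k ω).active = S} := by
    ext ω; simp
  rw [this]
  exact Finset.measurableSet_biUnion _ fun S _ => R.past.le _ _ (R.measurableSet_active hk S)

lemma measurableSet_validators {k : ℕ} (hk : k < K) (V : Finset (Fin n)) :
    MeasurableSet[R.past k] {ω | (R.round k ω).validators = V} := by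
  cases k with
  | zero =>
    simp only [R.validators_eq 0 hk, validatorsAt]
    exact MeasurableSet.const _
  | succ k =>
    have : {ω | (R.round (k + 1) ω).validators = V} =
        ⋃ e ∈ univ.filter (fun e : Draw n m => univ.image (fun t : Fin m => e (Sum.inl t)) = V),
          {ω | R.draw k ω = e} := by
      ext ω
      simp [R.validators_eq (k + 1) hk, validatorsAt]
    rw [this]
    exact Finset.measurableSet_biUnion _ fun e _ => R.draw_meas k (k.lt_succ_self.trans hk) e

lemma measurable_x {k : ℕ} (hk : k ≤ K) : Measurable (R.x k) :=
  (R.x_meas k hk).mono (R.past.le _) le_rfl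

lemma measure_draw_mem {k : ℕ} (hk : k < K) {A : Set Ω} (hA : MeasurableSet[R.mid k] A)
    (S : Finset (Fin n)) {F : Finset (Draw n m)} (hF : F ⊆ drawsIn m S) :
    μ (A ∩ {ω | (R.round (k + 1) ω).active = S} ∩ {ω | R.draw k ω ∈ F}) =
      #F * (μ (A ∩ {ω | (R.round (k + 1) ω).active = S}) /
        ((#S).descFactorial (2 * m) : ℝ≥0∞)) := by
  have e : A ∩ {ω | (R.round (k + 1) ω).active = S} ∩ {ω | R.draw k ω ∈ F} =
      ⋃ e ∈ F, A ∩ {ω | (R.round (k + 1) ω).active = S} ∩ {ω | R.draw k ω = e} := by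
    ext ω
    simp
  rw [e, measure_biUnion_finset]
  · rw [← nsmul_eq_mul, ← sum_const]
    exact sum_congr rfl fun e he => R.draw_law k hk A hA S e (mem_filter.1 (hF he)).2
  · intro e _ e' _ hne
    rw [Function.onFun, Set.disjoint_left]
    rintro ω ⟨-, h⟩ ⟨-, h'⟩
    exact hne (h.symm.trans h')
  · intro e _
    have h1 := R.mid_le hk _ hA
    have h2 := R.mid_le hk _ (R.active_meas k hk S)
    have h3 := R.past.le _ _ (R.draw_meas k hk e)
    exact (h1.inter h2).inter h3

/-- The law prescribes the probability of each draw from the remaining peers. These probabilities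
already sum to one, so other draws form a null set. -/
lemma ae_draw_mem [IsProbabilityMeasure μ] (hm2 : (m : ℝ) ≤ ((n : ℝ) - 2 * #byz) / 2)
    (hb : (#byz : ℝ) ≤ 0.1 * ((n : ℝ) - m)) {k : ℕ} (hk : k < K) :
    ∀ᵐ ω ∂μ, ∀ t, R.draw k ω t ∈ (R.round (k + 1) ω).active := by
  have key : ∀ S : Finset (Fin n), ∀ᵐ ω ∂μ, (R.round (k + 1) ω).active = S →
      R.draw k ω ∈ drawsIn m S := by
    intro S
    by_cases hS : 2 * m ≤ #S
    · have h := R.measure_draw_mem hk (A := Set.univ) MeasurableSet.univ S (subset_refl _)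
      have hpos : ((#S).descFactorial (2 * m) : ℝ≥0∞) ≠ 0 := by
        exact_mod_cast (Nat.descFactorial_pos.2 hS).ne'
      rw [card_drawsIn, ENNReal.mul_div_cancel hpos (ENNReal.natCast_ne_top _), Set.univ_inter] at h
      have hmeas : MeasurableSet {ω | R.draw k ω ∈ drawsIn m S} := by
        have : {ω | R.draw k ω ∈ drawsIn m S} = ⋃ e ∈ drawsIn m S, {ω | R.draw k ω = e} := by
          ext ω; simp
        rw [this]
        exact Finset.measurableSet_biUnion _ fun e _ => R.past.le _ _ (R.draw_meas k hk e)
      have h2 := measure_inter_add_sdiff (μ := μ) {ω | (R.round (k + 1) ω).active = S} hmeas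
      rw [h] at h2
      have h3 : μ ({ω | (R.round (k + 1) ω).active = S} \ {ω | R.draw k ω ∈ drawsIn m S}) = 0 := by
        have hfin := measure_ne_top μ {ω | (R.round (k + 1) ω).active = S}
        exact (ENNReal.add_right_inj hfin).1 (h2.trans (add_zero _).symm)
      rw [ae_iff]
      refine measure_mono_null (fun ω hω => ?_) h3
      simp only [Set.mem_ofPred_eq, Classical.not_imp] at hω
      exact hω
    · refine Filter.Eventually.of_forall fun ω hω => absurd ?_ hS
      rw [← hω]
      exact (R.card_active_bounds hm2 hb ω (k := k + 1) hk).1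
  filter_upwards [ae_all_iff.2 key] with ω hω
  exact (mem_filter.1 (hω _ rfl)).2

/-- From iteration `1` on there are exactly `n_k - m` participants almost surely. In iteration `0`
there are no validators and all `n` peers participate, hence the two-sided bound instead of an
equality. -/
lemma ae_card_participants [IsProbabilityMeasure μ]
    (hm2 : (m : ℝ) ≤ ((n : ℝ) - 2 * #byz) / 2)
    (hb : (#byz : ℝ) ≤ 0.1 * ((n : ℝ) - m)) {k : ℕ} (hk : k < K) :
    ∀ᵐ ω ∂μ, ((#(R.round k ω).active : ℝ) - m ≤ #(R.round k ω).participants ∧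
      (#(R.round k ω).participants : ℝ) ≤ 2 * (#(R.round k ω).active - m)) := by
  cases k with
  | zero =>
    refine Filter.Eventually.of_forall fun ω => ?_
    have h1 : (R.round 0 ω).participants = univ := by
      rw [Round.participants, R.validators_eq 0 hk, R.active_zero]
      simp [validatorsAt]
    have h2 : (0 : ℝ) ≤ #byz := by positivity
    have h3 : (0 : ℝ) ≤ m := by positivity
    rw [h1, R.active_zero, card_univ, Fintype.card_fin]
    constructor <;> linarith
  | succ k =>
    filter_upwards [R.ae_draw_mem hm2 hb (k.lt_succ_self.trans hk)] with ω hω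
    have hval : (R.round (k + 1) ω).validators =
        univ.image fun t : Fin m => R.draw k ω (Sum.inl t) := R.validators_eq (k + 1) hk ω
    have hsub : (R.round (k + 1) ω).validators ⊆ (R.round (k + 1) ω).active := by
      rw [hval]
      intro i hi
      obtain ⟨t, -, rfl⟩ := mem_image.1 hi
      exact hω _
    have hcard : #(R.round (k + 1) ω).validators = m := by
      rw [hval, card_image_of_injective univ (f := fun t => R.draw k ω (Sum.inl t))
        ((R.draw k ω).injective.comp Sum.inl_injective), card_univ, Fintype.card_fin]
    have h : (#(R.round (k + 1) ω).participants : ℝ) = #(R.round (k + 1) ω).active - m := by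
      rw [Round.participants, card_sdiff_of_subset hsub, Nat.cast_sub (card_le_card hsub), hcard]
    have h2 := (R.card_active_bounds hm2 hb ω hk.le).2.1
    have h3 : (0 : ℝ) ≤ 0.4 * n := by positivity
    rw [h]
    constructor <;> linarith

end BTARDSGD

lemma measure_eq_sum_inter_fiber {Ω β : Type*} [MeasurableSpace Ω] (μ : Measure Ω) [Fintype β]
    (h : Ω → β) (hh : ∀ b, MeasurableSet {ω | h ω = b}) (X : Set Ω) :
    μ X = ∑ b, μ (X ∩ {ω | h ω = b}) := by
  have h1 := sum_measure_preimage_singleton (μ := μ.restrict X) (f := h) univ fun b _ => hh b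
  simp only [coe_univ, Set.preimage_univ, Measure.restrict_apply MeasurableSet.univ,
    Set.univ_inter] at h1
  rw [← h1]
  refine sum_congr rfl fun b _ => ?_
  rw [Set.inter_comm]
  exact Measure.restrict_apply (hh b)

namespace BTARDSGD

variable {Ω : Type*} [mΩ : MeasurableSpace Ω] {μ : Measure Ω} [IsProbabilityMeasure μ]
  {Ξ : Type*} [MeasurableSpace Ξ]
  {D : Measure Ξ} {d n m : ℕ} {g : Vec d → Ξ → Vec d} {byz : Finset (Fin n)} {σ γ : ℝ} {x₀ : Vec d}
  {K : ℕ} (R : BTARDSGD μ D g byz m σ γ x₀ K)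

/-- An attacker is removed in the next two iterations with probability at least `m / (2n)`. -/
lemma measure_active_add_le (hm : 1 ≤ m) (hm2 : (m : ℝ) ≤ ((n : ℝ) - 2 * #byz) / 2)
    (hb : (#byz : ℝ) ≤ 0.1 * ((n : ℝ) - m)) {k : ℕ} (hk : k + 1 < K) {i : Fin n} (hi : i ∈ byz) :
    μ {ω | i ∈ (R.round (k + 2) ω).active} +
      m / (2 * n) * μ {ω | i ∈ (R.round k ω).attackers m σ} ≤
      μ {ω | i ∈ (R.round k ω).active} := by
  have hk' : k < K := k.lt_succ_self.trans hk
  set W := {ω | i ∈ (R.round k ω).attackers m σ} with hW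
  have hWm : MeasurableSet[R.mid k] W := R.attackers_meas k hk' i
  -- Either `i` is caught by the draw, which removes it at the end of iteration `k + 1`, or it is
  -- already gone before the draw. In both cases it is inactive in iteration `k + 2`.
  set H := {ω | i ∈ caught byz σ (R.round k ω) (R.draw k ω) ∨
    i ∉ (R.round (k + 1) ω).active} with hH
  have hn : 0 < n := by
    have := (R.card_active_bounds hm2 hb (μ := μ)
      (Classical.choice (nonempty_of_isProbabilityMeasure μ)) hk'.le).1
    have h2 := card_le_univ (R.round k (Classical.choice
      (nonempty_of_isProbabilityMeasure μ))).active
    rw [Fintype.card_fin] at h2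
    omega
  have hdisj : Disjoint {ω | i ∈ (R.round (k + 2) ω).active} (W ∩ H) := by
    rw [Set.disjoint_left]
    rintro ω h1 ⟨-, h2⟩
    rcases h2 with h2 | h2
    · have h3 := R.active_succ (k + 1) hk ω
      rw [Set.mem_ofPred_eq, h3, mem_sdiff] at h1
      exact h1.2 (mem_union_left _ (mem_union_left _ h2))
    · exact h2 (R.active_succ_subset hk ω h1)
  have hsub : {ω | i ∈ (R.round (k + 2) ω).active} ∪ (W ∩ H) ⊆
      {ω | i ∈ (R.round k ω).active} := by
    rintro ω (h | h)
    · exact R.active_succ_subset hk' ω (R.active_succ_subset hk ω h)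
    · exact (mem_inter.1 (R.attackers_subset hk' ω h.1)).1
  -- Given the set `S` of remaining peers, the draw is uniform and independent of the attack, so
  -- catching has probability `m #(S \ byz) / (#S (#S - 1))`. This is at least `m / (2n)` because
  -- good peers form at least half of `S`.
  have hmain : m / (2 * n) * μ W ≤ μ (W ∩ H) := by
    have hact : ∀ S, MeasurableSet {ω | (R.round (k + 1) ω).active = S} := fun S =>
      R.mid_le hk' _ (R.active_meas k hk' S)
    rw [measure_eq_sum_inter_fiber μ (fun ω => (R.round (k + 1) ω).active) hact W,
      measure_eq_sum_inter_fiber μ (fun ω => (R.round (k + 1) ω).active) hact (W ∩ H), mul_sum]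
    refine sum_le_sum fun S _ => ?_
    rcases Set.eq_empty_or_nonempty {ω | (R.round (k + 1) ω).active = S} with he | ⟨ω₀, hω₀⟩
    · rw [he, Set.inter_empty, measure_empty, mul_zero]; exact zero_le
    obtain ⟨hS1, -, hS3⟩ := R.card_active_bounds hm2 hb ω₀ (k := k + 1) hk'
    rw [Set.mem_ofPred_eq] at hω₀
    rw [hω₀] at hS1 hS3
    have hSn : #S ≤ n := by simpa using card_le_univ S
    by_cases hiS : i ∈ S
    · have h1 : W ∩ {ω | (R.round (k + 1) ω).active = S} ∩
          {ω | R.draw k ω ∈ catchingDraws m byz S i} ⊆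
          W ∩ H ∩ {ω | (R.round (k + 1) ω).active = S} := by
        rintro ω ⟨⟨hω1, hω2⟩, hω3⟩
        refine ⟨⟨hω1, Or.inl ?_⟩, hω2⟩
        obtain ⟨t, ht1, ht2⟩ := (mem_filter.1 hω3).2
        simp only [caught, mem_image, mem_filter, mem_univ, true_and]
        exact ⟨t, ⟨ht2, ht1 ▸ hω1⟩, ht1⟩
      refine le_trans ?_ (measure_mono h1)
      rw [R.measure_draw_mem hk' hWm S (F := catchingDraws m byz S i) (filter_subset _ _), ← card_drawsIn]
      have hF := card_catchingDraws (m := m) hiS hi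
      have hT : 0 < #(drawsIn m S) := by
        rw [card_drawsIn]; exact Nat.descFactorial_pos.2 hS1
      have hratio : (m : ℝ≥0∞) / (2 * n) ≤ #(catchingDraws m byz S i) / #(drawsIn m S) := by
        have hsd := card_sdiff_add_card_inter S byz
        have hgood : #S ≤ 2 * #(S \ byz) := by
          have h2 : (#(S \ byz) : ℝ) + #(S ∩ byz) = #S := by exact_mod_cast hsd
          have h3 : (0 : ℝ) ≤ m := by positivity
          have h4 : (0 : ℝ) ≤ #S := by positivity
          have : (#S : ℝ) ≤ 2 * #(S \ byz) := by linarith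
          exact_mod_cast this
        have hnat : m * #(drawsIn m S) ≤ #(catchingDraws m byz S i) * (2 * n) := by
          have hs0 : 0 < #S * (#S - 1) := Nat.mul_pos (by omega) (by omega)
          refine Nat.le_of_mul_le_mul_left ?_ hs0
          calc #S * (#S - 1) * (m * #(drawsIn m S))
              ≤ (2 * #(S \ byz)) * n * (m * #(drawsIn m S)) := by
                gcongr
                omega
            _ = m * #(S \ byz) * #(drawsIn m S) * (2 * n) := by ring
            _ = #S * (#S - 1) * (#(catchingDraws m byz S i) * (2 * n)) := by rw [← hF]; ring
        have hn0 : (2 * n : ℝ≥0∞) ≠ 0 := by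
          exact_mod_cast (by omega : 2 * n ≠ 0)
        have hn1 : (2 * n : ℝ≥0∞) ≠ ⊤ := by
          exact_mod_cast ENNReal.natCast_ne_top (2 * n)
        have hT0 : (#(drawsIn m S) : ℝ≥0∞) ≠ 0 := by exact_mod_cast hT.ne'
        rw [ENNReal.div_le_iff hn0 hn1, ← ENNReal.mul_div_right_comm,
          ENNReal.le_div_iff_mul_le (Or.inl hT0) (Or.inl (ENNReal.natCast_ne_top _))]
        exact_mod_cast hnat
      calc (m : ℝ≥0∞) / (2 * n) * μ (W ∩ {ω | (R.round (k + 1) ω).active = S})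
          ≤ #(catchingDraws m byz S i) / #(drawsIn m S) *
            μ (W ∩ {ω | (R.round (k + 1) ω).active = S}) := by gcongr
        _ = _ := by rw [div_eq_mul_inv, div_eq_mul_inv]; ring
    · have h1 : W ∩ {ω | (R.round (k + 1) ω).active = S} ⊆
          W ∩ H ∩ {ω | (R.round (k + 1) ω).active = S} := by
        rintro ω ⟨hω1, hω2⟩
        refine ⟨⟨hω1, Or.inr ?_⟩, hω2⟩
        rw [Set.mem_ofPred_eq] at hω2
        rwa [hω2]
      refine le_trans ?_ (measure_mono h1)
      refine mul_le_of_le_one_left zero_le ?_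
      refine ENNReal.div_le_of_le_mul ?_
      rw [one_mul]
      exact_mod_cast (by omega : m ≤ 2 * n)
  calc _ ≤ μ {ω | i ∈ (R.round (k + 2) ω).active} + μ (W ∩ H) := by gcongr
    _ = μ ({ω | i ∈ (R.round (k + 2) ω).active} ∪ (W ∩ H)) :=
      (measure_union' hdisj (R.measurableSet_mem_active (k := k + 2) hk i)).symm
    _ ≤ _ := measure_mono hsub

lemma sum_measure_attack_le (hm : 1 ≤ m) (hm2 : (m : ℝ) ≤ ((n : ℝ) - 2 * #byz) / 2)
    (hb : (#byz : ℝ) ≤ 0.1 * ((n : ℝ) - m)) {i : Fin n} (hi : i ∈ byz) :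
    m / (2 * n) * ∑ k ∈ range K, μ {ω | i ∈ (R.round k ω).attackers m σ} ≤ 3 := by
  rcases K.eq_zero_or_pos with hK | hK
  · simp [hK]
  have hmn : (m : ℝ≥0∞) / (2 * n) ≤ 1 := by
    refine ENNReal.div_le_of_le_mul ?_
    rw [one_mul]
    have h0 : (0 : ℝ) ≤ #byz := by positivity
    have h1 : (m : ℝ) ≤ 2 * n := by linarith [(Nat.cast_nonneg m : (0 : ℝ) ≤ m)]
    exact_mod_cast h1
  -- Bans take two iterations, so the telescoping potential is the sum of two consecutive activity
  -- probabilities, which is at most `2`. The attack of the last iteration cannot be charged to a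
  -- later ban and costs the additional `1`.
  have key : ∀ j, j < K → m / (2 * n) *
      ∑ k ∈ range j, μ {ω | i ∈ (R.round k ω).attackers m σ} +
      (μ {ω | i ∈ (R.round j ω).active} + μ {ω | i ∈ (R.round (j + 1) ω).active}) ≤ 2 := by
    intro j
    induction j with
    | zero =>
      intro _
      rw [sum_range_zero, mul_zero, zero_add, ← one_add_one_eq_two]
      exact add_le_add prob_le_one prob_le_one
    | succ j ih =>
      intro hj
      refine le_trans ?_ (ih (j.lt_succ_self.trans hj))
      have h := R.measure_active_add_le hm hm2 hb hj hi
      rw [sum_range_succ, mul_add, add_assoc]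
      refine add_le_add le_rfl ?_
      calc _ = μ {ω | i ∈ (R.round (j + 2) ω).active} +
            m / (2 * n) * μ {ω | i ∈ (R.round j ω).attackers m σ} +
            μ {ω | i ∈ (R.round (j + 1) ω).active} := by
            rw [show j + 1 + 1 = j + 2 from rfl]; ring
        _ ≤ _ := add_le_add h le_rfl
  obtain ⟨K', rfl⟩ : ∃ K', K = K' + 1 := ⟨K - 1, by omega⟩
  rw [sum_range_succ, mul_add]
  have h1 := key K' (by omega)
  have h2 : (m : ℝ≥0∞) / (2 * n) * μ {ω | i ∈ (R.round K' ω).attackers m σ} ≤ 1 :=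
    mul_le_one₀ hmn zero_le prob_le_one
  calc _ ≤ (2 : ℝ≥0∞) + 1 := add_le_add (le_self_add.trans h1) h2
    _ = 3 := by norm_num

/-- The expected total number of attacks. -/
lemma sum_lintegral_numAttack_le (hm : 1 ≤ m) (hm2 : (m : ℝ) ≤ ((n : ℝ) - 2 * #byz) / 2)
    (hb : (#byz : ℝ) ≤ 0.1 * ((n : ℝ) - m)) :
    m / (2 * n) * ∑ k ∈ range K, ∫⁻ ω, ((R.round k ω).numAttack : ℝ≥0∞) ∂μ ≤ 3 * #byz := by
  have h1 : ∀ k ∈ range K, ∫⁻ ω, ((R.round k ω).numAttack : ℝ≥0∞) ∂μ =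
      ∑ i ∈ byz, μ {ω | i ∈ (R.round k ω).attackers m σ} := by
    intro k hk
    have hk := mem_range.1 hk
    have hm : ∀ i, MeasurableSet {ω | i ∈ (R.round k ω).attackers m σ} := fun i =>
      R.mid_le hk _ (R.attackers_meas k hk i)
    have e : ∀ ω, ((R.round k ω).numAttack : ℝ≥0∞) =
        ∑ i ∈ byz, Set.indicator {ω | i ∈ (R.round k ω).attackers m σ} 1 ω := by
      intro ω
      simp only [Set.indicator_apply, Set.mem_ofPred_eq, Pi.one_apply]
      rw [R.numAttack_eq k hk, ← sum_filter, sum_const, nsmul_eq_mul, mul_one, filter_mem_eq_inter,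
        inter_eq_right.2 ((R.attackers_subset hk ω).trans inter_subset_right)]
    simp only [e]
    rw [lintegral_finsetSum _ fun i _ => measurable_one.indicator (hm i)]
    exact sum_congr rfl fun i _ => lintegral_indicator_one (hm i)
  rw [sum_congr rfl h1, sum_comm, mul_sum]
  calc _ ≤ ∑ i ∈ byz, (3 : ℝ≥0∞) :=
        sum_le_sum fun i hi => R.sum_measure_attack_le hm hm2 hb hi
    _ = _ := by rw [sum_const, nsmul_eq_mul, mul_comm]

end BTARDSGD

/-! ### Conditioning on the past -/

/-- Integrating over samples that are independent of the past. -/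
lemma setLIntegral_indep {Ω β Z : Type*} {𝓕 mΩ : MeasurableSpace Ω} [MeasurableSpace β]
    [MeasurableSpace Z] {μ : Measure Ω} [IsProbabilityMeasure μ] (h𝓕 : 𝓕 ≤ mΩ) {ξ : Ω → Z}
    (hξ : Measurable ξ) {ν : Measure Z} (hlaw : μ.map ξ = ν)
    (hind : Indep (MeasurableSpace.comap ξ inferInstance) 𝓕 μ) {E : Set Ω}
    (hE : MeasurableSet[𝓕] E) {x : Ω → β} (hx : Measurable[𝓕] x) {h : β × Z → ℝ≥0∞}
    (hh : Measurable h) :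
    ∫⁻ ω in E, h (x ω, ξ ω) ∂μ = ∫⁻ ω in E, ∫⁻ ζ, h (x ω, ζ) ∂ν ∂μ := by
  -- Carrying the indicator of `E` along with `x` makes both a function of the past, so that
  -- independence gives a product law and Tonelli applies to the restricted integral.
  set Y : Ω → β × ℝ≥0∞ := fun ω => (x ω, E.indicator 1 ω)
  have hY𝓕 : Measurable[𝓕] Y := hx.prodMk ((@measurable_const _ _ _ 𝓕 1).indicator hE)
  have hY : Measurable Y := hY𝓕.mono h𝓕 le_rfl
  have hE' : MeasurableSet E := h𝓕 _ hE
  have hνp : IsProbabilityMeasure ν := hlaw ▸ Measure.isProbabilityMeasure_map hξ.aemeasurable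
  have hYξ : IndepFun Y ξ μ :=
    (IndepFun_iff_Indep _ _ _).2 (indep_of_indep_of_le_left hind.symm hY𝓕.comap_le)
  have hmap := (indepFun_iff_map_prod_eq_prod_map_map hY.aemeasurable hξ.aemeasurable).1 hYξ
  have hmeas : Measurable fun q : (β × ℝ≥0∞) × Z => q.1.2 * h (q.1.1, q.2) :=
    (measurable_snd.comp measurable_fst).mul
      (hh.comp ((measurable_fst.comp measurable_fst).prodMk measurable_snd))
  have hl : ∀ F : Ω → ℝ≥0∞, ∫⁻ ω in E, F ω ∂μ = ∫⁻ ω, E.indicator 1 ω * F ω ∂μ := by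
    intro F
    rw [← lintegral_indicator hE']
    refine lintegral_congr fun ω => ?_
    by_cases hω : ω ∈ E <;> simp [hω]
  rw [hl, hl]
  calc ∫⁻ ω, E.indicator 1 ω * h (x ω, ξ ω) ∂μ
      = ∫⁻ q, q.1.2 * h (q.1.1, q.2) ∂(μ.map fun ω => (Y ω, ξ ω)) :=
        (lintegral_map hmeas (hY.prodMk hξ)).symm
    _ = ∫⁻ y, ∫⁻ ζ, y.2 * h (y.1, ζ) ∂ν ∂(μ.map Y) := by
        rw [hmap, hlaw, lintegral_prod _ hmeas.aemeasurable]
    _ = ∫⁻ ω, ∫⁻ ζ, (Y ω).2 * h ((Y ω).1, ζ) ∂ν ∂μ :=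
        lintegral_map hmeas.lintegral_prod_right' hY
    _ = _ := lintegral_congr fun ω =>
        lintegral_const_mul _ (hh.comp measurable_prodMk_left)

/-- Comparing integrals on the level sets of a countably valued function. -/
lemma lintegral_le_of_forall_fiber {Ω β : Type*} [MeasurableSpace Ω] {μ : Measure Ω} [Countable β]
    (h : Ω → β) (hh : ∀ b, MeasurableSet {ω | h ω = b}) {F G : Ω → ℝ≥0∞}
    (hFG : ∀ b, ∫⁻ ω in {ω | h ω = b}, F ω ∂μ ≤ ∫⁻ ω in {ω | h ω = b}, G ω ∂μ) :
    ∫⁻ ω, F ω ∂μ ≤ ∫⁻ ω, G ω ∂μ := by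
  have hU : (⋃ b, {ω | h ω = b}) = Set.univ := by ext ω; simp
  have hd : Pairwise (Function.onFun Disjoint fun b => {ω | h ω = b}) := fun b c hbc =>
    Set.disjoint_left.2 fun ω h1 h2 => hbc (h1.symm.trans h2)
  rw [← setLIntegral_univ F, ← setLIntegral_univ G, ← hU, lintegral_iUnion hh hd,
    lintegral_iUnion hh hd]
  exact ENNReal.tsum_le_tsum hFG

lemma Round.error_le_attackBound {d n : ℕ} (R : Round d n) {m : ℕ} {σ : ℝ} {ghat : Vec d}
    (G : Vec d) (hout : R.IsOutput m σ ghat) (hσ : 0 < σ)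
    (hcount : R.numAttack = #(R.attackers m σ)) (hpos : 0 < R.numAttack)
    (hN : (R.numAttack : ℝ) ≤ 0.1 * (#R.active - m)) (hP : (#R.active : ℝ) - m ≤ #R.participants)
    (hd : #R.participants ≤ d) :
    ‖ghat - G‖ ^ 2 ≤
      attackBound R.participants R.numAttack (#R.active - m) σ fun i => R.grad i - G := by
  have hc : (1 : ℝ) ≤ R.numAttack := by exact_mod_cast hpos
  have hN0 : (0 : ℝ) < #R.active - m := by linarith
  have hp : 10 ≤ #R.participants := by
    have : (10 : ℝ) ≤ #R.participants := by linarith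
    exact_mod_cast this
  have hδ : 0 < R.delta m := div_pos (by linarith) hN0
  refine R.error_le hout hσ.le hcount hδ.ne' hp (by linarith) fun j hj => ?_
  have hidx := card_filter_lt_lt_card hj
  have hS : d / #R.participants ≤ #(R.part j) := div_le_card_splitPart hidx
  have hS0 : 0 < #(R.part j) := (Nat.div_pos hd (by omega)).trans_le hS
  have hd0 : 0 < d := by omega
  refine (clipRadius_sq hδ ?_ ?_).1
  · rw [Round.delta, div_le_iff₀ hN0]; exact hN
  · positivity

/-! ### Expected decrease per iteration and its sum -/

namespace BTARDSGD

variable {Ω : Type*} [mΩ : MeasurableSpace Ω] {μ : Measure Ω} [IsProbabilityMeasure μ]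
  {Ξ : Type*} [MeasurableSpace Ξ] {D : Measure Ξ} [IsProbabilityMeasure D]
  {d n m : ℕ} {g : Vec d → Ξ → Vec d} {byz : Finset (Fin n)} {σ γ : ℝ} {x₀ : Vec d}
  {K : ℕ} (R : BTARDSGD μ D g byz m σ γ x₀ K)

variable {f : Vec d → ℝ} {s₀ : ℕ} {L fstar : ℝ}

/-- On this event of the past, `Q` and `c` are constants, so the fresh samples can be integrated out
at a frozen iterate. The bound `#Q ≥ 0.4 n` turns `1` and `8000000` into `2.5` and `20000000`. -/
lemma setLIntegral_step_le (hL : 0 ≤ L) (hf : LSmooth f L) (hstar : ∀ x, fstar ≤ f x)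
    (hg : Measurable (Function.uncurry g)) (hσ : 0 < σ) (hs : 1 ≤ s₀) (hd : n * s₀ ≤ d) (hn : 0 < n)
    (hv : BlockVariance D g f σ s₀) (hγ : 0 ≤ γ) (hγL : L * γ ≤ 1 / 4)
    {k : ℕ} (hk : k < K) (S V : Finset (Fin n)) (c : ℕ)
    (hN1 : 0.4 * (n : ℝ) ≤ #S - m) (hN2 : (#S : ℝ) - m ≤ #(S \ V))
    (hN3 : (#(S \ V) : ℝ) ≤ 2 * (#S - m)) (hN4 : (c : ℝ) ≤ 0.1 * (#S - m)) :
    ∫⁻ ω in {ω | ((R.round k ω).active, (R.round k ω).validators, (R.round k ω).numAttack) =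
        (S, V, c)}, (ENNReal.ofReal (f (R.x (k + 1) ω) - fstar) +
        ENNReal.ofReal (γ / 4 * ‖gradient f (R.x k ω)‖ ^ 2)) ∂μ ≤
    ∫⁻ ω in {ω | ((R.round k ω).active, (R.round k ω).validators, (R.round k ω).numAttack) =
        (S, V, c)}, (ENNReal.ofReal (f (R.x k ω) - fstar) +
        (ENNReal.ofReal (2.5 * (L * γ ^ 2 * σ ^ 2 / n)) +
          ENNReal.ofReal (20000000 * (γ * σ ^ 2 / n)) * (R.round k ω).numAttack)) ∂μ := by
  set E := {ω | ((R.round k ω).active, (R.round k ω).validators, (R.round k ω).numAttack) =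
        (S, V, c)} with hEdef
  have hE : ∀ ω ∈ E, (R.round k ω).active = S ∧ (R.round k ω).validators = V ∧
      (R.round k ω).numAttack = c := fun ω hω => by simpa [hEdef] using hω
  have hEm : MeasurableSet[R.past k] E := by
    have : E = {ω | (R.round k ω).active = S} ∩ ({ω | (R.round k ω).validators = V} ∩
        {ω | (R.round k ω).numAttack = c}) := by
      ext ω; simp [hEdef]
    rw [this]
    exact (R.measurableSet_active hk.le S).inter ((R.measurableSet_validators hk V).inter
      (R.numAttack_meas k hk c))
  have hEm' : MeasurableSet E := R.past.le _ _ hEm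
  have hn0 : (0 : ℝ) < n := by exact_mod_cast hn
  set Q := S \ V with hQdef
  have hQ' : 0.4 * (n : ℝ) ≤ #Q := hN1.trans hN2
  have hQ0 : (0 : ℝ) < #Q := by linarith
  have hQ : 0 < #Q := by exact_mod_cast hQ0
  have hd1 : s₀ ≤ d := (Nat.le_mul_of_pos_left s₀ hn).trans hd
  have hd0 : 0 < d := by omega
  have hξ : Measurable (R.ξ k) :=
    (R.ξ_meas k hk).mono (R.mid_le hk) le_rfl
  have hfc : Continuous f := hf.1.continuous
  have hdis : ∀ h : Vec d × (Fin n → Ξ) → ℝ≥0∞, Measurable h →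
      ∫⁻ ω in E, h (R.x k ω, R.ξ k ω) ∂μ =
        ∫⁻ ω in E, ∫⁻ ζ, h (R.x k ω, ζ) ∂(Measure.pi fun _ => D) ∂μ := fun h hh =>
    setLIntegral_indep (R.past.le k) hξ (R.ξ_law k hk) (R.ξ_indep k hk) hEm (R.x_meas k hk.le) hh
  have hgi : ∀ i, Measurable fun q : Vec d × (Fin n → Ξ) => g q.1 (q.2 i) := fun i =>
    hg.comp (measurable_fst.prodMk ((measurable_pi_apply i).comp measurable_snd))
  have hgm := hf.continuous_gradient.measurable
  have hpart : ∀ ω ∈ E, (R.round k ω).participants = Q := fun ω hω => by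
    rw [Round.participants, (hE ω hω).1, (hE ω hω).2.1]
  rcases Nat.eq_zero_or_pos c with hc | hc
  · have hgrad : ∀ ω ∈ E, R.ghat k ω =
        (1 / (#Q : ℝ)) • ∑ i ∈ Q, g (R.x k ω) (R.ξ k ω i) := by
      intro ω hω
      have h := (R.round k ω).ghat_eq_mean (R.ghat_output k hk ω) (R.numAttack_eq k hk ω)
        ((hE ω hω).2.2.trans hc) (by rw [hpart ω hω]; exact hQ)
      rw [h, hpart ω hω]
      congr 1
      exact sum_congr rfl fun i _ => R.grad_eq k hk ω i
    have hmeas : Measurable fun q : Vec d × (Fin n → Ξ) =>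
        ENNReal.ofReal (f (q.1 - γ • ((1 / (#Q : ℝ)) • ∑ i ∈ Q, g q.1 (q.2 i))) - fstar) +
        ENNReal.ofReal (γ / 4 * ‖gradient f q.1‖ ^ 2) := by
      have h1 : Measurable fun q : Vec d × (Fin n → Ξ) => ∑ i ∈ Q, g q.1 (q.2 i) :=
        Finset.measurable_fun_sum _ fun i _ => hgi i
      have h2 := hfc.measurable.comp (measurable_fst.sub ((h1.const_smul (1 / (#Q : ℝ))).const_smul γ))
      have h3 := ((hgm.comp (measurable_fst (α := Vec d) (β := Fin n → Ξ))).norm.pow_const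
        2).const_mul (γ / 4)
      exact (h2.sub_const fstar).ennreal_ofReal.add h3.ennreal_ofReal
    calc _ = ∫⁻ ω in E, (fun q : Vec d × (Fin n → Ξ) =>
        ENNReal.ofReal (f (q.1 - γ • ((1 / (#Q : ℝ)) • ∑ i ∈ Q, g q.1 (q.2 i))) - fstar) +
        ENNReal.ofReal (γ / 4 * ‖gradient f q.1‖ ^ 2)) (R.x k ω, R.ξ k ω) ∂μ := by
          refine setLIntegral_congr_fun hEm' fun ω hω => ?_
          simp only
          rw [R.x_succ k hk, hgrad ω hω]
      _ ≤ _ := by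
          rw [hdis _ hmeas]
          refine setLIntegral_mono' hEm' fun ω hω => ?_
          refine (hv.mean_step hg hd1 hd0 hL hf hγ hγL hstar Q hQ (R.x k ω)).trans ?_
          rw [ENNReal.ofReal_add (sub_nonneg.2 (hstar _)) (by positivity)]
          refine add_le_add le_rfl (le_add_right (ENNReal.ofReal_le_ofReal ?_))
          calc L * γ ^ 2 * σ ^ 2 / #Q ≤ L * γ ^ 2 * σ ^ 2 / (0.4 * n) := by gcongr
            _ = _ := by field_simp; ring
  · set N : ℝ := (#S : ℝ) - m with hN
    have hN0 : 0 < N := by linarith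
    -- The right-hand side depends on the current iteration only through its samples. This is the
    -- point at which the adversary's choices disappear, before any expectation is taken.
    have hpt : ∀ ω ∈ E, ENNReal.ofReal (f (R.x (k + 1) ω) - fstar) +
        ENNReal.ofReal (γ / 4 * ‖gradient f (R.x k ω)‖ ^ 2) ≤
        ENNReal.ofReal (f (R.x k ω) - fstar) + ENNReal.ofReal γ * ENNReal.ofReal
          (attackBound Q c N σ fun i => g (R.x k ω) (R.ξ k ω i) - gradient f (R.x k ω)) := by
      intro ω hω
      obtain ⟨h1, h2, h3⟩ := hE ω hω
      have herr := (R.round k ω).error_le_attackBound (gradient f (R.x k ω)) (R.ghat_output k hk ω)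
        hσ (R.numAttack_eq k hk ω) (h3 ▸ hc) (by rw [h1, h3]; exact hN4)
        (by rw [hpart ω hω, h1]; exact hN2) (by
          rw [hpart ω hω]
          have : #Q ≤ n := by simpa using card_le_univ Q
          exact (this.trans (Nat.le_mul_of_pos_right n hs)).trans hd)
      rw [hpart ω hω, h1, h3, ← hN] at herr
      simp only [R.grad_eq k hk ω] at herr
      have hstep := hf.step_le hγ hγL (R.x k ω) (R.ghat k ω)
      rw [← R.x_succ k hk ω] at hstep
      rw [← ENNReal.ofReal_mul hγ, ← ENNReal.ofReal_add (sub_nonneg.2 (hstar _)) (by positivity),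
        ← ENNReal.ofReal_add (sub_nonneg.2 (hstar _))
          (mul_nonneg hγ (attackBound_nonneg _ _ _ _ _))]
      refine ENNReal.ofReal_le_ofReal ?_
      have := mul_le_mul_of_nonneg_left herr hγ
      linarith
    have hfm : Measurable fun ω => ENNReal.ofReal (f (R.x k ω) - fstar) :=
      ((hfc.measurable.comp (R.measurable_x hk.le)).sub_const _).ennreal_ofReal
    refine (setLIntegral_mono' hEm' hpt).trans ?_
    rw [lintegral_add_left hfm, lintegral_add_left hfm]
    refine add_le_add le_rfl ?_
    have hmeas : Measurable fun q : Vec d × (Fin n → Ξ) => ENNReal.ofReal γ * ENNReal.ofReal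
        (attackBound Q c N σ fun i => g q.1 (q.2 i) - gradient f q.1) :=
      (measurable_attackBound Q c N σ fun i =>
        (hgi i).sub (hgm.comp measurable_fst)).ennreal_ofReal.const_mul _
    rw [hdis _ hmeas]
    refine setLIntegral_mono' hEm' fun ω hω => ?_
    have hcN : (c : ℝ) / N ≤ 0.1 := by rw [div_le_iff₀ hN0]; exact hN4
    have hmean := hv.meanLE_attackBound hg hσ hs hd Q hQ hc hN0 hN2 hN3 hcN (R.x k ω)
    rw [lintegral_const_mul' _ _ ENNReal.ofReal_ne_top, (hE ω hω).2.2]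
    calc _ ≤ ENNReal.ofReal γ * ENNReal.ofReal (8000000 * σ ^ 2 * c / #Q) := by
          gcongr
          exact hmean.lintegral_le fun ζ => attackBound_nonneg _ _ _ _ _
      _ = ENNReal.ofReal (γ * (8000000 * σ ^ 2 * c / #Q)) := (ENNReal.ofReal_mul hγ).symm
      _ ≤ ENNReal.ofReal (20000000 * (γ * σ ^ 2 / n) * c) := by
          refine ENNReal.ofReal_le_ofReal ?_
          calc γ * (8000000 * σ ^ 2 * c / #Q) ≤ γ * (8000000 * σ ^ 2 * c / (0.4 * n)) := by gcongr
            _ = _ := by field_simp; ring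
      _ = ENNReal.ofReal (20000000 * (γ * σ ^ 2 / n)) * c := by
          rw [ENNReal.ofReal_mul (by positivity), ENNReal.ofReal_natCast]
      _ ≤ _ := le_add_self

lemma lintegral_step_le (hL : 0 ≤ L) (hf : LSmooth f L) (hstar : ∀ x, fstar ≤ f x)
    (hg : Measurable (Function.uncurry g)) (hσ : 0 < σ) (hs : 1 ≤ s₀) (hd : n * s₀ ≤ d) (hn : 0 < n)
    (hv : BlockVariance D g f σ s₀) (hγ : 0 ≤ γ) (hγL : L * γ ≤ 1 / 4)
    (hm2 : (m : ℝ) ≤ ((n : ℝ) - 2 * #byz) / 2)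
    (hb : (#byz : ℝ) ≤ 0.1 * ((n : ℝ) - m)) {k : ℕ} (hk : k < K) :
    ∫⁻ ω, ENNReal.ofReal (f (R.x (k + 1) ω) - fstar) ∂μ +
        ENNReal.ofReal (γ / 4) * ∫⁻ ω, ‖gradient f (R.x k ω)‖ₑ ^ 2 ∂μ ≤
    ∫⁻ ω, ENNReal.ofReal (f (R.x k ω) - fstar) ∂μ +
        (ENNReal.ofReal (2.5 * (L * γ ^ 2 * σ ^ 2 / n)) +
          ENNReal.ofReal (20000000 * (γ * σ ^ 2 / n)) *
            ∫⁻ ω, ((R.round k ω).numAttack : ℝ≥0∞) ∂μ) := by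
  have hfm : ∀ j, j ≤ K → Measurable fun ω => ENNReal.ofReal (f (R.x j ω) - fstar) := fun j hj =>
    ((hf.1.continuous.measurable.comp (R.measurable_x hj)).sub_const _).ennreal_ofReal
  have hlabel : ∀ l : Finset (Fin n) × Finset (Fin n) × ℕ, MeasurableSet
      {ω | ((R.round k ω).active, (R.round k ω).validators, (R.round k ω).numAttack) = l} := by
    rintro ⟨S, V, c⟩
    have : {ω | ((R.round k ω).active, (R.round k ω).validators, (R.round k ω).numAttack) =
        (S, V, c)} = {ω | (R.round k ω).active = S} ∩ ({ω | (R.round k ω).validators = V} ∩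
        {ω | (R.round k ω).numAttack = c}) := by
      ext ω; simp
    rw [this]
    exact R.past.le _ _ ((R.measurableSet_active hk.le S).inter
      ((R.measurableSet_validators hk V).inter (R.numAttack_meas k hk c)))
  have h := lintegral_le_of_forall_fiber (μ := μ)
    (fun ω => ((R.round k ω).active, (R.round k ω).validators, (R.round k ω).numAttack)) hlabel
    (F := fun ω => ENNReal.ofReal (f (R.x (k + 1) ω) - fstar) +
        ENNReal.ofReal (γ / 4 * ‖gradient f (R.x k ω)‖ ^ 2))
    (G := fun ω => ENNReal.ofReal (f (R.x k ω) - fstar) +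
        (ENNReal.ofReal (2.5 * (L * γ ^ 2 * σ ^ 2 / n)) +
          ENNReal.ofReal (20000000 * (γ * σ ^ 2 / n)) * (R.round k ω).numAttack)) (by
      rintro ⟨S, V, c⟩
      -- Labels that violate the size bounds occur with probability zero, because the bounds on the
      -- number of participants hold only almost surely.
      by_cases hc : (0.4 * (n : ℝ) ≤ #S - m ∧ (c : ℝ) ≤ 0.1 * (#S - m)) ∧
        ((#S : ℝ) - m ≤ #(S \ V) ∧ (#(S \ V) : ℝ) ≤ 2 * (#S - m))
      · exact R.setLIntegral_step_le hL hf hstar hg hσ hs hd hn hv hγ hγL hk S V c hc.1.1 hc.2.1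
          hc.2.2 hc.1.2
      · have hnull : μ {ω | ((R.round k ω).active, (R.round k ω).validators,
            (R.round k ω).numAttack) = (S, V, c)} = 0 := by
          refine measure_mono_null (fun ω hω => ?_) (ae_iff.1 (R.ae_card_participants hm2 hb hk))
          simp only [Set.mem_ofPred_eq, Prod.mk.injEq] at hω ⊢
          obtain ⟨h1, h2, h3⟩ := hω
          intro hcard
          have hb1 := R.card_active_bounds hm2 hb ω hk.le
          have hb2 : ((R.round k ω).numAttack : ℝ) ≤ #((R.round k ω).active ∩ byz) := by
            rw [R.numAttack_eq k hk ω]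
            exact_mod_cast card_le_card (R.attackers_subset hk ω)
          rw [Round.participants, h1, h2] at hcard
          rw [h1] at hb1 hb2
          rw [h3] at hb2
          exact hc ⟨⟨hb1.2.1, hb2.trans hb1.2.2⟩, hcard⟩
        rw [Measure.restrict_eq_zero.2 hnull, lintegral_zero_measure, lintegral_zero_measure])
  rw [lintegral_add_left (hfm _ hk), lintegral_add_left (hfm _ hk.le),
    lintegral_add_left measurable_const, lintegral_const, measure_univ, mul_one,
    lintegral_const_mul' _ _ ENNReal.ofReal_ne_top] at h
  refine le_trans (le_of_eq ?_) h
  congr 1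
  rw [← lintegral_const_mul' _ _ ENNReal.ofReal_ne_top]
  refine lintegral_congr fun ω => ?_
  rw [ENNReal.ofReal_mul (by positivity), ENNReal.ofReal_pow (norm_nonneg _), ofReal_norm]

lemma sum_lintegral_gradient_le (hL : 0 ≤ L) (hf : LSmooth f L) (hstar : ∀ x, fstar ≤ f x)
    (hg : Measurable (Function.uncurry g)) (hσ : 0 < σ) (hs : 1 ≤ s₀) (hd : n * s₀ ≤ d)
    (hv : BlockVariance D g f σ s₀) (hγ : 0 ≤ γ) (hγL : L * γ ≤ 1 / 4) (hm : 1 ≤ m)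
    (hm2 : (m : ℝ) ≤ ((n : ℝ) - 2 * #byz) / 2)
    (hb : (#byz : ℝ) ≤ 0.1 * ((n : ℝ) - m)) :
    ENNReal.ofReal (γ / 4) * ∑ k ∈ range K, ∫⁻ ω, ‖gradient f (R.x k ω)‖ₑ ^ 2 ∂μ ≤
      ENNReal.ofReal (f x₀ - fstar + K * (2.5 * (L * γ ^ 2 * σ ^ 2 / n)) +
        20000000 * (γ * σ ^ 2 / n) * (6 * n * #byz / m)) := by
  have hm' : (1 : ℝ) ≤ m := by exact_mod_cast hm
  have hn' : (0 : ℝ) < n := by linarith [(Nat.cast_nonneg #byz : (0 : ℝ) ≤ #byz)]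
  have hn : 0 < n := by exact_mod_cast hn'
  have key : ∀ j, j ≤ K → ∫⁻ ω, ENNReal.ofReal (f (R.x j ω) - fstar) ∂μ +
      ENNReal.ofReal (γ / 4) * ∑ k ∈ range j, ∫⁻ ω, ‖gradient f (R.x k ω)‖ₑ ^ 2 ∂μ ≤
      ENNReal.ofReal (f x₀ - fstar) + (j * ENNReal.ofReal (2.5 * (L * γ ^ 2 * σ ^ 2 / n)) +
        ENNReal.ofReal (20000000 * (γ * σ ^ 2 / n)) *
          ∑ k ∈ range j, ∫⁻ ω, ((R.round k ω).numAttack : ℝ≥0∞) ∂μ) := by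
    intro j
    induction j with
    | zero =>
      intro _
      simp [R.x_zero]
    | succ j ih =>
      intro hj
      have h1 := ih (by omega)
      have h2 := R.lintegral_step_le hL hf hstar hg hσ hs hd hn hv hγ hγL hm2 hb (k := j) hj
      rw [sum_range_succ, sum_range_succ, mul_add, mul_add]
      generalize ∫⁻ ω, ENNReal.ofReal (f (R.x (j + 1) ω) - fstar) ∂μ = a' at *
      generalize ∫⁻ ω, ENNReal.ofReal (f (R.x j ω) - fstar) ∂μ = a at *
      generalize ENNReal.ofReal (γ / 4) * ∑ k ∈ range j, ∫⁻ ω, ‖gradient f (R.x k ω)‖ₑ ^ 2 ∂μ =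
        s at *
      generalize ENNReal.ofReal (γ / 4) * ∫⁻ ω, ‖gradient f (R.x j ω)‖ₑ ^ 2 ∂μ = t at *
      generalize ENNReal.ofReal (20000000 * (γ * σ ^ 2 / n)) *
          ∑ k ∈ range j, ∫⁻ ω, ((R.round k ω).numAttack : ℝ≥0∞) ∂μ = u at *
      generalize ENNReal.ofReal (20000000 * (γ * σ ^ 2 / n)) *
          ∫⁻ ω, ((R.round j ω).numAttack : ℝ≥0∞) ∂μ = v at *
      generalize ENNReal.ofReal (2.5 * (L * γ ^ 2 * σ ^ 2 / n)) = A at *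
      push_cast
      calc a' + (s + t) = s + (a' + t) := by ring
        _ ≤ s + (a + (A + v)) := by gcongr
        _ = (a + s) + (A + v) := by ring
        _ ≤ (ENNReal.ofReal (f x₀ - fstar) + (j * A + u)) + (A + v) := by gcongr
        _ = _ := by ring
  have hatt : ∑ k ∈ range K, ∫⁻ ω, ((R.round k ω).numAttack : ℝ≥0∞) ∂μ ≤
      ENNReal.ofReal (6 * n * #byz / m) := by
    have h := R.sum_lintegral_numAttack_le hm hm2 hb
    have hm0 : (m : ℝ≥0∞) ≠ 0 := by exact_mod_cast (by omega : m ≠ 0)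
    have hn0 : (2 * n : ℝ≥0∞) ≠ 0 := by exact_mod_cast (by omega : 2 * n ≠ 0)
    have hn1 : (2 * n : ℝ≥0∞) ≠ ⊤ := by exact_mod_cast ENNReal.natCast_ne_top (2 * n)
    rw [ENNReal.ofReal_div_of_pos (by linarith), ENNReal.ofReal_natCast,
      ENNReal.le_div_iff_mul_le (Or.inl hm0) (Or.inl (ENNReal.natCast_ne_top _))]
    rw [← ENNReal.mul_div_right_comm, ENNReal.div_le_iff hn0 hn1] at h
    calc _ = (m : ℝ≥0∞) * ∑ k ∈ range K, ∫⁻ ω, ((R.round k ω).numAttack : ℝ≥0∞) ∂μ := mul_comm _ _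
      _ ≤ _ := h
      _ = ((6 * n * #byz : ℕ) : ℝ≥0∞) := by push_cast; ring
      _ = _ := by
        rw [← ENNReal.ofReal_natCast]
        push_cast
        rfl
  have hA : 0 ≤ L * γ ^ 2 * σ ^ 2 / n := by positivity
  have hB : 0 ≤ γ * σ ^ 2 / n := by positivity
  have hb0 : (0 : ℝ) ≤ 6 * n * #byz / m := by positivity
  rw [ENNReal.ofReal_add (add_nonneg (sub_nonneg.2 (hstar _)) (by positivity)) (by positivity),
    ENNReal.ofReal_add (sub_nonneg.2 (hstar _)) (by positivity), ENNReal.ofReal_mul (by positivity),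
    ENNReal.ofReal_natCast, ENNReal.ofReal_mul (q := 6 * n * #byz / m) (by positivity), add_assoc]
  refine le_add_self.trans ((key K le_rfl).trans ?_)
  gcongr

end BTARDSGD

/-! ### The step size and the conclusion -/

lemma expectedSqGrad_eq {Ω : Type*} [MeasurableSpace Ω] (μ : Measure Ω) [IsProbabilityMeasure μ]
    {d : ℕ} {f : Vec d → ℝ} (hf : Continuous (gradient f)) {x : ℕ → Ω → Vec d} {K : ℕ}
    (hx : ∀ k < K, Measurable (x k)) :
    expectedSqGrad μ f x K =
      (K : ℝ≥0∞)⁻¹ * ∑ k ∈ range K, ∫⁻ ω, ‖gradient f (x k ω)‖ₑ ^ 2 ∂μ := by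
  have hm : ∀ j : Fin K, Measurable fun ω => ‖gradient f (x j ω)‖ₑ ^ 2 := fun j =>
    (hf.measurable.comp (hx j j.2)).enorm.pow_const 2
  have hmeas : Measurable fun p : Ω × Fin K => ‖gradient f (x p.2 p.1)‖ₑ ^ 2 :=
    measurable_from_prod_countable_left fun j => hm j
  rw [expectedSqGrad, lintegral_prod _ hmeas.aemeasurable]
  have h1 : ∀ F : Fin K → ℝ≥0∞, ∫⁻ j, F j ∂(uniformOn (Set.univ : Set (Fin K))) =
      (K : ℝ≥0∞)⁻¹ * ∑ j, F j := by
    intro F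
    rw [uniformOn, ProbabilityTheory.cond, Measure.restrict_univ, lintegral_smul_measure,
      lintegral_count, tsum_fintype, Measure.count_univ]
    simp
  simp only [h1]
  rw [lintegral_const_mul _ (Finset.measurable_fun_sum _ fun j _ => hm j),
    lintegral_finsetSum _ fun j _ => hm j,
    Finset.sum_range fun k => ∫⁻ ω, ‖gradient f (x k ω)‖ₑ ^ 2 ∂μ]

/-- The radical `r` equalises `Δ₀ / (r K)` and `L r σ² / n`; their common value `s` is the square
root of `w`. Since `γ` is a minimum, `1 / γ ≤ 4 L + 1 / r` while `γ ≤ r`, and everything reduces to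
`16 u + 14 s + 480000000 y`, with `u`, `w` and `y` controlled by one summand of the iteration bound
each. -/
lemma stepSize_bound {L Δ₀ σ ε n b m K : ℝ} (hL : 0 < L) (hΔ : 0 < Δ₀) (hσ : 0 < σ) (hε : 0 < ε)
    (hn : 0 < n) (hb : 0 ≤ b) (hm : 0 < m) (hK : 0 < K)
    (h : 10 ^ 10 * (L * Δ₀ / ε ^ 2 + L * Δ₀ * σ ^ 2 / (n * ε ^ 4) + n * (b / n) * σ ^ 2 / (m * ε ^ 2))
      ≤ K) {γ : ℝ} (hγ : γ = min (1 / (4 * L)) (√(Δ₀ * n / (L * σ ^ 2 * K)))) :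
    0 < γ ∧ K⁻¹ * ((γ / 4)⁻¹ * (Δ₀ + K * (2.5 * (L * γ ^ 2 * σ ^ 2 / n)) +
        20000000 * (γ * σ ^ 2 / n) * (6 * n * b / m))) ≤ ε ^ 2 := by
  set r := √(Δ₀ * n / (L * σ ^ 2 * K)) with hr
  have hr0 : 0 < r := Real.sqrt_pos.2 (by positivity)
  have hr2 : r ^ 2 = Δ₀ * n / (L * σ ^ 2 * K) := Real.sq_sqrt (by positivity)
  have hγ0 : 0 < γ := by rw [hγ]; exact lt_min (by positivity) hr0
  have hγr : γ ≤ r := hγ ▸ min_le_right _ _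
  have hγinv : 1 / γ ≤ 4 * L + 1 / r := by
    rcases min_choice (1 / (4 * L)) r with h1 | h1
    · rw [hγ, h1, one_div_one_div]
      have : 0 < 1 / r := by positivity
      linarith
    · rw [hγ, h1]; linarith
  refine ⟨hγ0, ?_⟩
  set u := L * Δ₀ / K
  set w := L * Δ₀ * σ ^ 2 / (n * K)
  set y := σ ^ 2 * b / (m * K)
  set s := L * r * σ ^ 2 / n with hs
  have hs2 : s ^ 2 = w := by
    have : s ^ 2 = L ^ 2 * σ ^ 4 / n ^ 2 * r ^ 2 := by rw [hs]; ring
    rw [this, hr2]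
    simp only [w]
    field_simp
  have hΔr : Δ₀ / (r * K) = s := by
    have h1 : Δ₀ = r ^ 2 * (L * σ ^ 2 * K) / n := by rw [hr2]; field_simp
    rw [hs]
    rw [h1]
    field_simp
  have ha : 0 ≤ L * Δ₀ / ε ^ 2 := by positivity
  have hc : 0 ≤ L * Δ₀ * σ ^ 2 / (n * ε ^ 4) := by positivity
  have he : 0 ≤ n * (b / n) * σ ^ 2 / (m * ε ^ 2) := by positivity
  have hu : u ≤ ε ^ 2 / 10 ^ 10 := by
    have h1 : 10 ^ 10 * (L * Δ₀ / ε ^ 2) ≤ K := by linarith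
    rw [mul_div_assoc', div_le_iff₀ (by positivity)] at h1
    rw [div_le_div_iff₀ hK (by positivity)]
    linarith
  have hw : w ≤ ε ^ 4 / 10 ^ 10 := by
    have h1 : 10 ^ 10 * (L * Δ₀ * σ ^ 2 / (n * ε ^ 4)) ≤ K := by linarith
    rw [mul_div_assoc', div_le_iff₀ (by positivity)] at h1
    rw [div_le_div_iff₀ (by positivity) (by positivity)]
    linarith
  have hy : y ≤ ε ^ 2 / 10 ^ 10 := by
    have h1 : 10 ^ 10 * (n * (b / n) * σ ^ 2 / (m * ε ^ 2)) ≤ K := by linarith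
    rw [mul_div_cancel₀ _ hn.ne', mul_div_assoc', div_le_iff₀ (by positivity)] at h1
    rw [div_le_div_iff₀ (by positivity) (by positivity)]
    linarith
  have hsε : s ≤ ε ^ 2 / 10 ^ 5 := by
    refine abs_le_of_sq_le_sq' ?_ (by positivity) |>.2
    rw [hs2]
    refine hw.trans (le_of_eq ?_)
    ring
  have hsplit : K⁻¹ * ((γ / 4)⁻¹ * (Δ₀ + K * (2.5 * (L * γ ^ 2 * σ ^ 2 / n)) +
        20000000 * (γ * σ ^ 2 / n) * (6 * n * b / m))) =
      4 * (1 / γ * (Δ₀ / K)) + 10 * (L * γ * σ ^ 2 / n) + 480000000 * y := by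
    simp only [y]
    field_simp
    ring
  have h1 : 1 / γ * (Δ₀ / K) ≤ 4 * u + s := by
    calc 1 / γ * (Δ₀ / K) ≤ (4 * L + 1 / r) * (Δ₀ / K) := by gcongr
      _ = 4 * u + Δ₀ / (r * K) := by simp only [u]; field_simp
      _ = _ := by rw [hΔr]
  have h2 : L * γ * σ ^ 2 / n ≤ s := by rw [hs]; gcongr
  have hε2 : 0 < ε ^ 2 := by positivity
  rw [hsplit]
  linarith

theorem mainTheorem1 :
    ∃ C : ℝ, 0 < C ∧
      ∀ {Ω : Type*} [MeasurableSpace Ω] (μ : Measure Ω) [IsProbabilityMeasure μ]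
        {Ξ : Type*} [MeasurableSpace Ξ] (D : Measure Ξ) [IsProbabilityMeasure D]
        (d n m b s₀ K : ℕ) (byz : Finset (Fin n))
        (f : Vec d → ℝ) (g : Vec d → Ξ → Vec d) (x₀ : Vec d) (L σ fstar ε : ℝ),
        0 < L → LSmooth f L → (∀ x, fstar ≤ f x) →
        Measurable (Function.uncurry g) →
        0 < σ → 1 ≤ s₀ → n * s₀ ≤ d →
        BlockVariance D g f σ s₀ → SubQuadraticTails D g f σ s₀ →
        #byz = b → 1 ≤ m → (b : ℝ) ≤ 0.1 * ((n : ℝ) - m) → (m : ℝ) ≤ ((n : ℝ) - 2 * b) / 2 →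
        0 < ε → 1 ≤ K →
        C * (L * (f x₀ - fstar) / ε ^ 2 + L * (f x₀ - fstar) * σ ^ 2 / (n * ε ^ 4) +
            n * ((b : ℝ) / n) * σ ^ 2 / (m * ε ^ 2)) ≤ K →
        ∀ R : BTARDSGD μ D g byz m σ (stepSize L (f x₀ - fstar) σ n K) x₀ K,
          expectedSqGrad μ f R.x K ≤ ENNReal.ofReal (ε ^ 2) := by
  refine ⟨10 ^ 10, by norm_num, ?_⟩
  intro Ω _ μ _ Ξ _ D _ d n m b s₀ K byz f g x₀ L σ fstar ε hL hf hstar hg hσ hs hd hv _ hbyz hm hb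
    hm2 hε hK hKC R
  subst hbyz
  have hm' : (1 : ℝ) ≤ m := by exact_mod_cast hm
  have hK' : (0 : ℝ) < K := by exact_mod_cast hK
  have hn' : (0 : ℝ) < n := by linarith [(Nat.cast_nonneg #byz : (0 : ℝ) ≤ #byz)]
  have hKE : (K : ℝ≥0∞)⁻¹ = ENNReal.ofReal (K : ℝ)⁻¹ := by
    rw [ENNReal.ofReal_inv_of_pos hK', ENNReal.ofReal_natCast]
  generalize hγdef : stepSize L (f x₀ - fstar) σ n K = γ at R
  rw [expectedSqGrad_eq μ hf.continuous_gradient fun k hk => R.measurable_x hk.le]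
  -- If `Δ₀ = 0` the step size vanishes and cannot be divided by, but then the iterates stay at
  -- `x₀`, which is a minimiser with zero gradient.
  rcases (sub_nonneg.2 (hstar x₀)).eq_or_lt with hΔ | hΔ
  · have hγ : γ = 0 := by
      rw [← hγdef, stepSize, ← hΔ]
      simp only [zero_mul, zero_div, Real.sqrt_zero]
      exact min_eq_right (by positivity)
    subst hγ
    have hx : ∀ k ≤ K, ∀ ω, R.x k ω = x₀ := by
      intro k
      induction k with
      | zero => exact fun _ ω => R.x_zero ω
      | succ k ih =>
        intro hk ω
        rw [R.x_succ k hk ω, zero_smul, sub_zero, ih (by omega) ω]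
    have hG : gradient f x₀ = 0 := gradient_eq_zero_of_forall_ge fun y => by
      linarith [hstar y]
    have h0 : ∑ k ∈ range K, ∫⁻ ω, ‖gradient f (R.x k ω)‖ₑ ^ 2 ∂μ = 0 :=
      sum_eq_zero fun k hk => by
        simp [hx k (mem_range.1 hk).le, hG]
    rw [h0, mul_zero]
    exact zero_le
  · obtain ⟨hγ0, hfin⟩ := stepSize_bound hL hΔ hσ hε hn' (Nat.cast_nonneg #byz)
      (by linarith : (0 : ℝ) < m) hK' hKC hγdef.symm
    have hγL : L * γ ≤ 1 / 4 := by
      have h1 : γ ≤ 1 / (4 * L) := hγdef ▸ min_le_left _ _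
      rw [le_div_iff₀ (by positivity)] at h1
      linarith
    have h := R.sum_lintegral_gradient_le hL.le hf hstar hg hσ hs hd hv hγ0.le hγL hm hm2 hb
    have hγ4 : 0 < γ / 4 := by positivity
    have h1 : ∑ k ∈ range K, ∫⁻ ω, ‖gradient f (R.x k ω)‖ₑ ^ 2 ∂μ ≤
        ENNReal.ofReal ((γ / 4)⁻¹ * (f x₀ - fstar + K * (2.5 * (L * γ ^ 2 * σ ^ 2 / n)) +
        20000000 * (γ * σ ^ 2 / n) * (6 * n * #byz / m))) := by
      rw [ENNReal.ofReal_mul (by positivity), ENNReal.ofReal_inv_of_pos hγ4, mul_comm,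
        ← div_eq_mul_inv, ENNReal.le_div_iff_mul_le
          (Or.inl (ENNReal.ofReal_pos.2 hγ4).ne') (Or.inl ENNReal.ofReal_ne_top), mul_comm]
      exact h
    calc _ ≤ (K : ℝ≥0∞)⁻¹ * ENNReal.ofReal ((γ / 4)⁻¹ * (f x₀ - fstar +
          K * (2.5 * (L * γ ^ 2 * σ ^ 2 / n)) +
          20000000 * (γ * σ ^ 2 / n) * (6 * n * #byz / m))) := by gcongr
      _ ≤ _ := by
        rw [hKE, ← ENNReal.ofReal_mul (by positivity)]
        exact ENNReal.ofReal_le_ofReal hfin
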